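/- Let $k$ be a field, $R=k[x_1,\dots,x_n]$, and let $d\ge 1$. A $d$-graph $H$ with vertex set $V\subseteq[n]$ is a set of $d$-element subsets (edges) of $V$. For $v\in V$ the $v$-layer of $H$ is the $(d-1)$-graph with vertex set $\{w\in V: w>v\}$ whose edges are the sets $e$ with $v<w$ for all $w\in e$ and $e\cup\{v\}\in H$. Every $1$-graph is cointerval; for $d>1$, $H$ is cointerval if all its layers are cointerval and, for all vertices $i<j$, every edge of the $j$-layer is an edge of the $i$-layer. Let $H$ be a cointerval $d$-graph with edge ideal $I=I_H$, generated by the monomials $m=\prod_{i\in e}x_i$, $e\in H$; we identify $m$ with the edge $e$. List the generators as $m_1,\dots,m_r$ in decreasing lexicographic order ($x_1>x_2>\cdots$), put $I_j=\langle m_1,\dots,m_j\rangle$ and $H_j=\{m_1,\dots,m_j\}$, and let $\mathrm{set}(m_j)=\{v\in[n]: x_v\in I_{j-1}:m_j\}$. For any $d$-graph $G$ let $X_G$ be the polyhedral complex whose cells are the products of simplices $\sigma_1\times\cdots\times\sigma_d$ with nonempty $\sigma_\ell\subseteq[n]$, $\sigma_1<\cdots<\sigma_d$ (elementwise), such that $\{v_1,\dots,v_d\}\in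 G$ whenever $v_\ell\in\sigma_\ell$ for all $\ell$; the cell has dimension $\sum_\ell(|\sigma_\ell|-1)$ and is labelled by the monomial $\prod_\ell\prod_{v\in\sigma_\ell}x_v$. Let $\mathcal F_G$ be the labelled cellular complex of $X_G$: it is $R$ (spanned by the empty face) in degree $0$ and free on the $(i-1)$-dimensional cells in degree $i\ge1$; the differential sends a vertex to its label, and a cell of positive dimension to $$\sum_{\ell=1}^d\ \sum_{j}(-1)^{\ell-1+j+|\sigma_1|+\cdots+|\sigma_{\ell-1}|}\,x_v\;\sigma_1\times\cdots\times(\sigma_\ell\setminus v)\times\cdots\times\sigma_d ,$$ where $v$ is the $j$-th smallest element of $\sigma_\ell$ and only $\ell$ with $|\sigma_\ell|\ge2$ occur. Then the following hold. 1. $\mathcal F=\mathcal F_H$ is a minimal $\mathbb Z^n$-graded free resolution of $R/I$. 2. For $m=x_{i_1}\cdots x_{i_d}\in H$ with $i_1<\cdots<i_d$ and $\alpha\subseteq\mathrm{set}(m)$, let $(m;\alpha)$ be the cell $\sigma_1\times\cdots\times\sigma_d$ with $\sigma_\ell=\{i_\ell\}\cup\{j\in\alpha: i_{\ell-1}<j<i_\ell\}$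 ($i_0=0$). For every $i\ge1$ this is a bijection from the symbols $(m;\alpha)$ with $m\in H$, $\alpha\subseteq\mathrm{set}(m)$, $|\alpha|=i-1$ onto the $(i-1)$-dimensional cells of $X_H$, so that these symbols form a basis of $\mathcal F_i$. 3. $\mathcal F$ is an iterated mapping cone: $\mathcal F_{H_0}$ is $R$ in degree $0$, and for $1\le j\le r$ the complex $\mathcal F_{H_{j-1}}$ is a minimal graded free resolution of $R/I_{j-1}$, the Koszul complex $K$ on the variables $x_v$, $v\in\mathrm{set}(m_j)$, is a minimal graded free resolution of $R/(I_{j-1}:m_j)$, and there are a chain map $\psi:K\to\mathcal F_{H_{j-1}}$ lifting the map $R/(I_{j-1}:m_j)\to R/I_{j-1}$ given by multiplication by $m_j$ and an isomorphism from the mapping cone of $\psi$ to $\mathcal F_{H_j}$ that sends the basis element $e_\alpha$ of $K$ to $(m_j;\alpha)$ and every face of $X_{H_{j-1}}$ to the same face of $X_{H_j}$. 4. For $m=x_{i_1}\cdots x_{i_d}\in H$ as above and $i\in\mathrm{set}(m)$ let $c(x_im)=x_im/x_{i_\ell}$, where $i_\ell$ is the least element of $m$ with $i\le i_\ell$. Let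 $A_\ell$ be the set of all $j$ with $i_{\ell-1}<j<i_\ell$ and $x_jm/x_{i_\ell}\in I$, and for $\alpha\subseteq\mathrm{set}(m)$ let $T(\alpha)$ be the set of the maxima of the nonempty sets among $\alpha\cap A_1,\dots,\alpha\cap A_d$. If $\alpha=\{j_1<\cdots<j_p\}\subseteq\mathrm{set}(m)$ is nonempty, then $c(x_{j_i}m)$ is a generator of $I$ with $\alpha\setminus j_i\subseteq\mathrm{set}(c(x_{j_i}m))$ for each $j_i\in T(\alpha)$, and the differential of $\mathcal F$ is $$d(m;\alpha)=\sum_{j_i\in\alpha}(-1)^i x_{j_i}(m;\alpha\setminus j_i)+\sum_{j_i\in T(\alpha)}(-1)^{i-1}\frac{x_{j_i}m}{c(x_{j_i}m)}\,(c(x_{j_i}m);\alpha\setminus j_i);$$ moreover $d(m;\emptyset)=m$. -/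

import Mathlib

open CategoryTheory MvPolynomial

namespace HomCone

noncomputable section

/-! ### Hypergraphs, cointerval hypergraphs and their edge ideals -/

/-- The `v`-layer of a hypergraph: the sets `e` with all elements larger than `v`
such that `e ∪ {v}` is an edge. -/
def layer {n : ℕ} (H : Finset (Finset (Fin n))) (v : Fin n) : Finset (Finset (Fin n)) :=
  Finset.univ.filter fun e => (∀ w ∈ e, v < w) ∧ insert v e ∈ H

/-- `H` is the edge set of a cointerval `d`-graph with vertex set `V` (where `d ≥ 1`).
The vertices of the `v`-layer are the vertices larger than `v`. -/
def IsCointerval {n : ℕ} : ℕ → Finset (Fin n) → Finset (Finset (Fin n)) → Prop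
  | 0, _, _ => False
  | 1, V, H => ∀ e ∈ H, e ⊆ V ∧ e.card = 1
  | d + 2, V, H =>
      (∀ e ∈ H, e ⊆ V ∧ e.card = d + 2) ∧
      (∀ v ∈ V, IsCointerval (d + 1) (V.filter fun w => v < w) (layer H v)) ∧
      (∀ i ∈ V, ∀ j ∈ V, i < j → layer H j ⊆ layer H i)

/-- The exponent vector of the squarefree monomial `∏ i ∈ e, x_i`. -/
def expo {n : ℕ} (e : Finset (Fin n)) : Fin n →₀ ℕ := ∑ i ∈ e, Finsupp.single i 1

/-- The squarefree monomial `∏ i ∈ e, x_i`. -/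
def mon (k : Type*) [Field k] {n : ℕ} (e : Finset (Fin n)) : MvPolynomial (Fin n) k :=
  monomial (expo e) 1

/-- The edge ideal: it is generated by the monomials of the edges. -/
def edgeIdeal (k : Type*) [Field k] {n : ℕ} (H : Finset (Finset (Fin n))) :
    Ideal (MvPolynomial (Fin n) k) :=
  Ideal.span (mon k '' (H : Set (Finset (Fin n))))

/-- The edges whose monomials come before that of `m` in the lexicographic order with
`x_1 > x_2 > ⋯`, where the largest monomial comes first. -/
def before {n : ℕ} (H : Finset (Finset (Fin n))) (m : Finset (Fin n)) :
    Finset (Finset (Fin n)) :=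
  H.filter fun m' => toLex (expo m) < toLex (expo m')

open Classical in
/-- `set(m)`: the indices `v` for which `x_v` lies in the colon ideal `J : m`, where `J` is
generated by the generators that come before `m`. -/
def linSet (k : Type*) [Field k] {n : ℕ} (H : Finset (Finset (Fin n))) (m : Finset (Fin n)) :
    Finset (Fin n) :=
  Finset.univ.filter fun v =>
    (X v : MvPolynomial (Fin n) k) ∈ (edgeIdeal k (before H m)).colon {mon k m}

/-- The part `A_ℓ` of `set(m)`, indexed by the `ℓ`-th element `p = i_ℓ` of `m`:
all `j` strictly between `i_{ℓ-1}` and `i_ℓ` such that `x_j m / x_{i_ℓ}` lies in the edge ideal. -/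
def IsInPart (k : Type*) [Field k] {n : ℕ} (H : Finset (Finset (Fin n)))
    (m : Finset (Fin n)) (p j : Fin n) : Prop :=
  (∀ q ∈ m, q < p → q < j) ∧ j < p ∧ mon k (insert j (m.erase p)) ∈ edgeIdeal k H

open Classical in
/-- `T(α)`: the maxima of the nonempty sets among the `α ∩ A_ℓ`. -/
def topSet (k : Type*) [Field k] {n : ℕ} (H : Finset (Finset (Fin n)))
    (m α : Finset (Fin n)) : Finset (Fin n) :=
  α.filter fun j => ∃ p ∈ m, IsGreatest {t | t ∈ α ∧ IsInPart k H m p t} j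

open Classical in
/-- The modified decomposition function `c(x_i m) = x_i m / x_p`, where `p` is the least element
of `m` with `i ≤ p`. -/
def decomp {n : ℕ} (i : Fin n) (m : Finset (Fin n)) : Finset (Fin n) :=
  insert i (m.filter fun p => ¬ IsLeast {q | q ∈ m ∧ i ≤ q} p)

/-- The position of `j` in the increasing enumeration of `α`, starting with `1`. -/
def pos {n : ℕ} (α : Finset (Fin n)) (j : Fin n) : ℕ := (α.filter fun t => t ≤ j).card

/-! ### Complexes of free modules with a basis -/

/-- The chain complex with the free module on `B i` in degree `i` and the differentials `D i`. -/
abbrev freeComplex {R : Type*} [CommRing R] (B : ℕ → Type)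
    (D : ∀ i, (B (i + 1) →₀ R) →ₗ[R] (B i →₀ R)) (hD : ∀ i, D i ∘ₗ D (i + 1) = 0) :
    ChainComplex (ModuleCat R) ℕ :=
  ChainComplex.of (fun i => ModuleCat.of R (B i →₀ R)) (fun i => ModuleCat.ofHom (D i))
    (fun i => by rw [← ModuleCat.ofHom_comp, hD i]; rfl)

/-- The complex `F`, with augmentation `ε`, is a minimal `ℤⁿ`-graded free resolution of `R / I`,
`R = k[x_1, …, x_n]`, where the basis element `b i s` has the degree `deg i s`. -/
structure IsMinimalGradedFreeResolution {k : Type*} [Field k] {n : ℕ} {B : ℕ → Type}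
    (I : Ideal (MvPolynomial (Fin n) k))
    (F : ChainComplex (ModuleCat (MvPolynomial (Fin n) k)) ℕ)
    (b : ∀ i, Module.Basis (B i) (MvPolynomial (Fin n) k) (F.X i))
    (deg : ∀ i, B i → (Fin n →₀ ℕ))
    (ε : F.X 0 →ₗ[MvPolynomial (Fin n) k] (MvPolynomial (Fin n) k ⧸ I)) : Prop where
  finite : ∀ i, Finite (B i)
  homogeneous : ∀ i s t, ∀ u ∈ ((b i).repr ((F.d (i + 1) i).hom (b (i + 1) s)) t).support,
    u + deg i t = deg (i + 1) s
  aug_homogeneous : ∀ s, ∃ a : k, ε (b 0 s) = Ideal.Quotient.mk I (monomial (deg 0 s) a)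
  aug_surjective : Function.Surjective ε
  exact_zero : Function.Exact (F.d 1 0).hom ε
  exact_succ : ∀ i, Function.Exact (F.d (i + 2) (i + 1)).hom (F.d (i + 1) i).hom
  minimal : ∀ i x, (F.d (i + 1) i).hom x ∈
    Ideal.span (Set.range (X : Fin n → MvPolynomial (Fin n) k)) •
      (⊤ : Submodule (MvPolynomial (Fin n) k) (F.X i))

/-! ### The Koszul complex on a set of variables -/

/-- The basis of the Koszul complex on the variables in `S`, in degree `i`. -/
abbrev KoszulIndex {n : ℕ} (S : Finset (Fin n)) (i : ℕ) : Type :=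
  {α : Finset (Fin n) // α ⊆ S ∧ α.card = i}

/-- The basis element `e_α` (zero if `α` is not an `i`-element subset of `S`). -/
def koszulVec (k : Type*) [Field k] {n : ℕ} (S : Finset (Fin n)) (i : ℕ) (α : Finset (Fin n)) :
    KoszulIndex S i →₀ MvPolynomial (Fin n) k :=
  if h : α ⊆ S ∧ α.card = i then Finsupp.single ⟨α, h⟩ 1 else 0

/-- The differential `e_α ↦ ∑_{j_i ∈ α} (-1)^{i-1} x_{j_i} e_{α ∖ j_i}`. -/
def koszulD (k : Type*) [Field k] {n : ℕ} (S : Finset (Fin n)) (i : ℕ) :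
    (KoszulIndex S (i + 1) →₀ MvPolynomial (Fin n) k) →ₗ[MvPolynomial (Fin n) k]
      (KoszulIndex S i →₀ MvPolynomial (Fin n) k) :=
  Finsupp.linearCombination _ fun α =>
    ∑ j ∈ α.1, ((-1) ^ (pos α.1 j + 1) * X j : MvPolynomial (Fin n) k) •
      koszulVec k S i (α.1.erase j)

/-! ### The homomorphism complex -/

/-- `σ_1 × ⋯ × σ_d` is a (nonempty) cell of the homomorphism complex `X_H`: the sets are
nonempty, `σ_1 < ⋯ < σ_d`, and all its vertices are edges of `H`. -/
def IsCell {n : ℕ} (d : ℕ) (H : Finset (Finset (Fin n))) (σ : Fin d → Finset (Fin n)) : Prop :=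
  (∀ l, (σ l).Nonempty) ∧
  (∀ l l', l < l' → ∀ x ∈ σ l, ∀ y ∈ σ l', x < y) ∧
  (∀ v : Fin d → Fin n, (∀ l, v l ∈ σ l) → Finset.univ.image v ∈ H)

/-- The dimension of a product of simplices. -/
def cellDim {n d : ℕ} (σ : Fin d → Finset (Fin n)) : ℕ := ∑ l, ((σ l).card - 1)

/-- The exponent vector of the monomial label `∏_l ∏_{v ∈ σ_l} x_v` of a cell. -/
def cellLabel {n d : ℕ} (σ : Fin d → Finset (Fin n)) : Fin n →₀ ℕ := ∑ l, expo (σ l)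

/-- The faces of `X_H` in homological degree `i`: the empty face for `i = 0`, and the cells of
dimension `i - 1` for `i > 0`. -/
inductive CellIndex {n : ℕ} (d : ℕ) (H : Finset (Finset (Fin n))) : ℕ → Type
  | empty : CellIndex d H 0
  | cell {i : ℕ} (σ : Fin d → Finset (Fin n)) (h : IsCell d H σ ∧ cellDim σ = i) :
      CellIndex d H (i + 1)

/-- The cell `σ_1 × ⋯ × σ_d` as a tuple of sets. -/
def CellIndex.sets {n d : ℕ} {H : Finset (Finset (Fin n))} {i : ℕ} :
    CellIndex d H (i + 1) → (Fin d → Finset (Fin n))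
  | .cell σ _ => σ

open Classical in
/-- The basis element of an `i`-dimensional cell of `X_H`, in homological degree `i + 1` (zero if
`σ` is not such a cell). -/
def cellVec (k : Type*) [Field k] {n : ℕ} (d : ℕ) (H : Finset (Finset (Fin n))) (i : ℕ)
    (σ : Fin d → Finset (Fin n)) : CellIndex d H (i + 1) →₀ MvPolynomial (Fin n) k :=
  if h : IsCell d H σ ∧ cellDim σ = i then Finsupp.single (.cell σ h) 1 else 0

/-- The facet of `σ` obtained by removing `v` from `σ_l`. -/
def del {n d : ℕ} (σ : Fin d → Finset (Fin n)) (l : Fin d) (v : Fin n) :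
    Fin d → Finset (Fin n) :=
  Function.update σ l ((σ l).erase v)

/-- The exponent `(l - 1) + j + |σ_1| + ⋯ + |σ_{l-1}|` of the incidence sign of the facet that
omits the `j`-th element `v` of `σ_l` (here `l : Fin d` counts from zero). -/
def signExp {n d : ℕ} (σ : Fin d → Finset (Fin n)) (l : Fin d) (v : Fin n) : ℕ :=
  l + (pos (σ l) v + ∑ l' ∈ Finset.Iio l, (σ l').card)

/-- The pairs `(l, v)` such that `v` can be removed from `σ_l` leaving a nonempty set. -/
def removable {n d : ℕ} (σ : Fin d → Finset (Fin n)) : Finset (Fin d × Fin n) :=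
  Finset.univ.filter fun q => q.2 ∈ σ q.1 ∧ 2 ≤ (σ q.1).card

/-- The differential of the cellular complex of the labelled complex `X_H`. The coefficient of
a facet is the incidence sign times the quotient of the labels, which is `x_v` if `v` is the
element removed; the boundary of a vertex is its label times the empty face. -/
def cellD (k : Type*) [Field k] {n : ℕ} (d : ℕ) (H : Finset (Finset (Fin n))) : ∀ i : ℕ,
    (CellIndex d H (i + 1) →₀ MvPolynomial (Fin n) k) →ₗ[MvPolynomial (Fin n) k]
      (CellIndex d H i →₀ MvPolynomial (Fin n) k)
  | 0 => Finsupp.linearCombination _ fun σ =>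
      Finsupp.single .empty (monomial (cellLabel σ.sets) 1)
  | i + 1 => Finsupp.linearCombination _ fun σ =>
      ∑ q ∈ removable σ.sets, ((-1) ^ signExp σ.sets q.1 q.2 * X q.2 : MvPolynomial (Fin n) k) •
        cellVec k d H i (del σ.sets q.1 q.2)

theorem pos_erase_of_lt {n : ℕ} {α : Finset (Fin n)} {s t : Fin n} (hs : s ∈ α) (h : s < t) :
    pos (α.erase s) t + 1 = pos α t := by
  unfold pos
  rw [Finset.filter_erase, Finset.card_erase_add_one]
  simp [hs, h.le]

theorem pos_erase_of_gt {n : ℕ} {α : Finset (Fin n)} {s t : Fin n} (h : t < s) :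
    pos (α.erase s) t = pos α t := by
  unfold pos
  rw [Finset.filter_erase, Finset.erase_eq_of_notMem]
  simp [h]

theorem koszulD_koszulVec (k : Type*) [Field k] {n : ℕ} (S : Finset (Fin n)) (i : ℕ)
    (α : Finset (Fin n)) (h : α ⊆ S ∧ α.card = i + 1) :
    koszulD k S i (koszulVec k S (i + 1) α) =
      ∑ j ∈ α, ((-1) ^ (pos α j + 1) * X j : MvPolynomial (Fin n) k) •
        koszulVec k S i (α.erase j) := by
  rw [koszulVec, dif_pos h, koszulD, Finsupp.linearCombination_single, one_smul]

theorem koszulD_comp (k : Type*) [Field k] {n : ℕ} (S : Finset (Fin n)) (i : ℕ) :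
    koszulD k S i ∘ₗ koszulD k S (i + 1) = 0 := by
  refine Finsupp.lhom_ext' fun α => LinearMap.ext_ring ?_
  obtain ⟨α, hS, hc⟩ := α
  simp only [LinearMap.comp_apply, Finsupp.lsingle_apply, LinearMap.zero_apply]
  have h1 : (Finsupp.single ⟨α, hS, hc⟩ 1 : KoszulIndex S (i + 1 + 1) →₀ MvPolynomial (Fin n) k)
      = koszulVec k S (i + 1 + 1) α := by rw [koszulVec, dif_pos ⟨hS, hc⟩]
  rw [h1, koszulD_koszulVec k S _ α ⟨hS, hc⟩, map_sum]
  have h2 : ∀ j ∈ α, koszulD k S i (((-1) ^ (pos α j + 1) * X j : MvPolynomial (Fin n) k) •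
      koszulVec k S (i + 1) (α.erase j)) = ∑ t ∈ α.erase j,
      ((-1) ^ (pos α j + 1) * X j * ((-1) ^ (pos (α.erase j) t + 1) * X t) :
        MvPolynomial (Fin n) k) • koszulVec k S i ((α.erase j).erase t) := by
    intro j hj
    rw [map_smul, koszulD_koszulVec k S _ _
      ⟨(Finset.erase_subset _ _).trans hS, by rw [Finset.card_erase_of_mem hj, hc]; rfl⟩,
      Finset.smul_sum]
    simp only [smul_smul]
  rw [Finset.sum_congr rfl h2, Finset.sum_sigma']
  refine Finset.sum_involution (fun q _ => ⟨q.2, q.1⟩) ?_ ?_ ?_ ?_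
  · rintro ⟨s, t⟩ hq
    simp only [Finset.mem_sigma, Finset.mem_erase] at hq
    obtain ⟨hs, hts, ht⟩ := hq
    simp only
    rw [Finset.erase_right_comm (a := t) (b := s), ← add_smul]
    have : ((-1) ^ (pos α s + 1) * X s * ((-1) ^ (pos (α.erase s) t + 1) * X t) +
        (-1) ^ (pos α t + 1) * X t * ((-1) ^ (pos (α.erase t) s + 1) * X s) :
        MvPolynomial (Fin n) k) = 0 := by
      rcases lt_or_gt_of_ne hts with h | h
      · rw [pos_erase_of_gt h, ← pos_erase_of_lt ht h]; ring
      · rw [pos_erase_of_gt h, ← pos_erase_of_lt hs h]; ring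
    rw [this, zero_smul]
  · rintro ⟨s, t⟩ hq _ h
    simp only [Finset.mem_sigma, Finset.mem_erase] at hq
    simp only [Sigma.mk.injEq] at h
    exact hq.2.1 h.1
  · rintro ⟨s, t⟩ hq
    simp only [Finset.mem_sigma, Finset.mem_erase] at hq ⊢
    exact ⟨hq.2.2, hq.2.1.symm, hq.1⟩
  · rintro ⟨s, t⟩ _
    rfl

theorem mem_removable {n d : ℕ} {σ : Fin d → Finset (Fin n)} {q : Fin d × Fin n} :
    q ∈ removable σ ↔ q.2 ∈ σ q.1 ∧ 2 ≤ (σ q.1).card := by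
  simp [removable]

theorem del_subset {n d : ℕ} (σ : Fin d → Finset (Fin n)) (l : Fin d) (v : Fin n) (l' : Fin d) :
    del σ l v l' ⊆ σ l' := by
  unfold del
  rcases eq_or_ne l' l with rfl | h
  · simpa using Finset.erase_subset _ _
  · simp [h]

theorem isCell_del {n d : ℕ} {H : Finset (Finset (Fin n))} {σ : Fin d → Finset (Fin n)}
    (hσ : IsCell d H σ) {q : Fin d × Fin n} (hq : q ∈ removable σ) :
    IsCell d H (del σ q.1 q.2) := by
  rw [mem_removable] at hq
  refine ⟨fun l => ?_, fun l l' hl x hx y hy => hσ.2.1 l l' hl x (del_subset _ _ _ _ hx) y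
    (del_subset _ _ _ _ hy), fun v hv => hσ.2.2 v fun l => del_subset _ _ _ _ (hv l)⟩
  unfold del
  rcases eq_or_ne l q.1 with rfl | h
  · rw [Function.update_self, ← Finset.card_pos, Finset.card_erase_of_mem hq.1]
    omega
  · simpa [h] using hσ.1 l

theorem cellDim_del {n d : ℕ} {σ : Fin d → Finset (Fin n)} {q : Fin d × Fin n}
    (hq : q ∈ removable σ) : cellDim (del σ q.1 q.2) + 1 = cellDim σ := by
  rw [mem_removable] at hq
  unfold cellDim
  rw [← Finset.add_sum_erase _ _ (Finset.mem_univ q.1),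
    ← Finset.add_sum_erase (Finset.univ) (fun l => (σ l).card - 1) (Finset.mem_univ q.1)]
  have : ∀ l ∈ Finset.univ.erase q.1, (del σ q.1 q.2 l).card - 1 = (σ l).card - 1 := by
    intro l hl
    simp [del, Finset.ne_of_mem_erase hl]
  rw [Finset.sum_congr rfl this]
  simp only [del, Function.update_self, Finset.card_erase_of_mem hq.1]
  omega

theorem cellLabel_del {n d : ℕ} {σ : Fin d → Finset (Fin n)} {q : Fin d × Fin n}
    (hq : q ∈ removable σ) : Finsupp.single q.2 1 + cellLabel (del σ q.1 q.2) = cellLabel σ := by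
  rw [mem_removable] at hq
  unfold cellLabel
  rw [← Finset.add_sum_erase _ _ (Finset.mem_univ q.1),
    ← Finset.add_sum_erase (Finset.univ) (fun l => expo (σ l)) (Finset.mem_univ q.1)]
  have : ∀ l ∈ Finset.univ.erase q.1, expo (del σ q.1 q.2 l) = expo (σ l) := by
    intro l hl
    simp [del, Finset.ne_of_mem_erase hl]
  rw [Finset.sum_congr rfl this, ← add_assoc]
  congr 1
  simp only [del, Function.update_self, expo]
  exact Finset.add_sum_erase _ _ hq.1

theorem cellD_cellVec (k : Type*) [Field k] {n : ℕ} (d : ℕ) (H : Finset (Finset (Fin n))) (i : ℕ)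
    (σ : Fin d → Finset (Fin n)) (h : IsCell d H σ ∧ cellDim σ = i + 1) :
    cellD k d H (i + 1) (cellVec k d H (i + 1) σ) =
      ∑ q ∈ removable σ, ((-1) ^ signExp σ q.1 q.2 * X q.2 : MvPolynomial (Fin n) k) •
        cellVec k d H i (del σ q.1 q.2) := by
  rw [cellVec, dif_pos h, cellD, Finsupp.linearCombination_single, one_smul]
  rfl

theorem cellD_zero_cellVec (k : Type*) [Field k] {n : ℕ} (d : ℕ) (H : Finset (Finset (Fin n)))
    (σ : Fin d → Finset (Fin n)) (h : IsCell d H σ ∧ cellDim σ = 0) :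
    cellD k d H 0 (cellVec k d H 0 σ) =
      Finsupp.single .empty (monomial (cellLabel σ) 1) := by
  rw [cellVec, dif_pos h, cellD, Finsupp.linearCombination_single, one_smul]
  rfl

theorem sum_Iio_del {n d : ℕ} {σ : Fin d → Finset (Fin n)} {l l' : Fin d} {v : Fin n}
    (hv : v ∈ σ l) (h : l < l') :
    ∑ a ∈ Finset.Iio l', (del σ l v a).card + 1 = ∑ a ∈ Finset.Iio l', (σ a).card := by
  have hl : l ∈ Finset.Iio l' := by simpa using h
  rw [← Finset.add_sum_erase _ _ hl, ← Finset.add_sum_erase _ (fun a => (σ a).card) hl]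
  have : ∀ a ∈ (Finset.Iio l').erase l, (del σ l v a).card = (σ a).card := by
    intro a ha
    simp [del, Finset.ne_of_mem_erase ha]
  rw [Finset.sum_congr rfl this]
  simp only [del, Function.update_self]
  rw [← Finset.card_erase_add_one hv]
  omega

theorem sum_Iio_del_of_le {n d : ℕ} {σ : Fin d → Finset (Fin n)} {l l' : Fin d} {v : Fin n}
    (h : l' ≤ l) :
    ∑ a ∈ Finset.Iio l', (del σ l v a).card = ∑ a ∈ Finset.Iio l', (σ a).card := by
  refine Finset.sum_congr rfl fun a ha => ?_
  have : a ≠ l := ((Finset.mem_Iio.1 ha).trans_le h).ne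
  simp [del, this]

/-- Removing `q` first changes the sign of `q'` exactly if `q` comes before `q'`. -/
theorem signExp_del {n d : ℕ} {σ : Fin d → Finset (Fin n)} {l l' : Fin d} {v v' : Fin n}
    (hv : v ∈ σ l) (h : l < l' ∨ l = l' ∧ v < v') :
    signExp (del σ l v) l' v' + 1 = signExp σ l' v' ∧
      signExp (del σ l' v') l v = signExp σ l v := by
  unfold signExp
  rcases h with h | ⟨rfl, h⟩
  · have h1 := sum_Iio_del hv h
    rw [sum_Iio_del_of_le h.le]
    have h2 : del σ l v l' = σ l' := by simp [del, h.ne']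
    have h3 : del σ l' v' l = σ l := by simp [del, h.ne]
    rw [h2, h3]
    exact ⟨by omega, rfl⟩
  · rw [sum_Iio_del_of_le le_rfl, sum_Iio_del_of_le le_rfl]
    simp only [del, Function.update_self]
    rw [pos_erase_of_gt h, ← pos_erase_of_lt hv h]
    exact ⟨by omega, rfl⟩

theorem del_comm {n d : ℕ} (σ : Fin d → Finset (Fin n)) (l l' : Fin d) (v v' : Fin n) :
    del (del σ l v) l' v' = del (del σ l' v') l v := by
  unfold del
  rcases eq_or_ne l l' with rfl | h
  · simp [Finset.erase_right_comm]
  · rw [Function.update_comm h]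
    simp [h, h.symm]

theorem removable_swap {n d : ℕ} {σ : Fin d → Finset (Fin n)} {q q' : Fin d × Fin n}
    (hq : q ∈ removable σ) (hq' : q' ∈ removable (del σ q.1 q.2)) :
    q' ∈ removable σ ∧ q ∈ removable (del σ q'.1 q'.2) ∧ q ≠ q' := by
  obtain ⟨l, v⟩ := q
  obtain ⟨l', v'⟩ := q'
  simp only [mem_removable, del] at *
  rcases eq_or_ne l l' with rfl | h
  · simp only [Function.update_self, Finset.mem_erase, Finset.card_erase_of_mem hq.1] at hq' ⊢
    rw [Finset.card_erase_of_mem hq'.1.2]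
    refine ⟨⟨hq'.1.2, hq.2⟩, ⟨⟨hq'.1.1.symm, hq.1⟩, hq'.2⟩, ?_⟩
    rintro h
    exact hq'.1.1 (by simpa using h.symm)
  · simp only [Function.update_of_ne h, Function.update_of_ne h.symm] at hq' ⊢
    exact ⟨hq', hq, fun e => h (congrArg Prod.fst e)⟩

theorem sign_cancel {n d : ℕ} {A : Type*} [CommRing A] {σ : Fin d → Finset (Fin n)}
    {q q' : Fin d × Fin n}
    (hq : q ∈ removable σ) (hq' : q' ∈ removable σ) (hne : q ≠ q') :
    ((-1) ^ signExp σ q.1 q.2 * (-1) ^ signExp (del σ q.1 q.2) q'.1 q'.2 : A) +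
      (-1) ^ signExp σ q'.1 q'.2 * (-1) ^ signExp (del σ q'.1 q'.2) q.1 q.2 = 0 := by
  have key : ∀ q q' : Fin d × Fin n, q ∈ removable σ →
      (q.1 < q'.1 ∨ q.1 = q'.1 ∧ q.2 < q'.2) →
      ((-1) ^ signExp σ q.1 q.2 * (-1) ^ signExp (del σ q.1 q.2) q'.1 q'.2 : A) +
      (-1) ^ signExp σ q'.1 q'.2 * (-1) ^ signExp (del σ q'.1 q'.2) q.1 q.2 = 0 := by
    intro q q' hq h
    obtain ⟨h1, h2⟩ := signExp_del (mem_removable.1 hq).1 h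
    rw [h2, ← h1]
    ring
  rcases lt_trichotomy q.1 q'.1 with h | h | h
  · exact key q q' hq (Or.inl h)
  · rcases lt_trichotomy q.2 q'.2 with h' | h' | h'
    · exact key q q' hq (Or.inr ⟨h, h'⟩)
    · exact absurd (Prod.ext h h') hne
    · rw [add_comm]
      exact key q' q hq' (Or.inr ⟨h.symm, h'⟩)
  · rw [add_comm]
    exact key q' q hq' (Or.inl h)

theorem cellD_comp (k : Type*) [Field k] {n : ℕ} (d : ℕ) (H : Finset (Finset (Fin n))) (i : ℕ) :
    cellD k d H i ∘ₗ cellD k d H (i + 1) = 0 := by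
  refine Finsupp.lhom_ext' fun σ => LinearMap.ext_ring ?_
  rcases σ with _ | @⟨_, σ, hσ⟩
  simp only [LinearMap.comp_apply, Finsupp.lsingle_apply, LinearMap.zero_apply]
  have h1 : (Finsupp.single (.cell σ hσ) 1 : CellIndex d H (i + 1 + 1) →₀ MvPolynomial (Fin n) k)
      = cellVec k d H (i + 1) σ := by rw [cellVec, dif_pos hσ]
  rw [h1, cellD_cellVec k d H _ σ hσ, map_sum]
  cases i with
  | zero =>
    have h2 : ∀ q ∈ removable σ, cellD k d H 0
        (((-1) ^ signExp σ q.1 q.2 * X q.2 : MvPolynomial (Fin n) k) •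
          cellVec k d H 0 (del σ q.1 q.2)) =
        Finsupp.single .empty ((-1) ^ signExp σ q.1 q.2 * monomial (cellLabel σ) 1) := by
      intro q hq
      have hdim := cellDim_del hq
      have hd1 : cellDim σ = 0 + 1 := hσ.2
      rw [map_smul, cellD_zero_cellVec k d H _ ⟨isCell_del hσ.1 hq, by omega⟩,
        Finsupp.smul_single, smul_eq_mul, mul_assoc, X, monomial_mul, cellLabel_del hq, one_mul]
    rw [Finset.sum_congr rfl h2]
    have hd1 : cellDim σ = 1 := hσ.2
    have huniq : ∀ q ∈ removable σ, ∀ q' ∈ removable σ, q.1 = q'.1 := by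
      intro q hq q' hq'
      by_contra hne
      have h' := cellDim_del hq
      have hq'' : q' ∈ removable (del σ q.1 q.2) := by
        rw [mem_removable] at hq' ⊢
        simpa [del, Ne.symm hne] using hq'
      have := cellDim_del hq''
      omega
    have hcard : ∀ q ∈ removable σ, (σ q.1).card = 2 := by
      intro q hq
      have h := mem_removable.1 hq
      have h' : (σ q.1).card - 1 ≤ cellDim σ :=
        Finset.single_le_sum (f := fun l => (σ l).card - 1) (fun _ _ => Nat.zero_le _)
          (Finset.mem_univ q.1)
      omega
    rcases (removable σ).eq_empty_or_nonempty with he | ⟨⟨l, a⟩, hq⟩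
    · rw [he, Finset.sum_empty]
    · obtain ⟨u, w, huw, hl⟩ := Finset.card_eq_two.1 (hcard _ hq)
      simp only at hl
      wlog hlt : u < w generalizing u w
      · exact this w u huw.symm (by rw [hl, Finset.pair_comm])
          (lt_of_le_of_ne (not_lt.1 hlt) huw.symm)
      have hrem : removable σ = {(l, u), (l, w)} := by
        ext ⟨l', v⟩
        constructor
        · intro hm
          obtain rfl : l' = l := huniq _ hm _ hq
          have := (mem_removable.1 hm).1
          simp only [hl, Finset.mem_insert, Finset.mem_singleton] at this
          rcases this with rfl | rfl <;> simp
        · intro hm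
          simp only [Finset.mem_insert, Finset.mem_singleton, Prod.mk.injEq] at hm
          rw [mem_removable]
          rcases hm with ⟨rfl, rfl⟩ | ⟨rfl, rfl⟩ <;> simp [hl, huw]
      rw [hrem, Finset.sum_pair (by simp [huw]), ← Finsupp.single_add]
      have hu : pos (σ l) u = 1 := by
        rw [pos, hl]
        have : ({u, w} : Finset (Fin n)).filter (fun t => t ≤ u) = {u} := by
          ext t
          simp only [Finset.mem_filter, Finset.mem_insert, Finset.mem_singleton]
          constructor
          · rintro ⟨rfl | rfl, h⟩
            · rfl
            · exact absurd h (not_le.2 hlt)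
          · rintro rfl
            simp
        rw [this, Finset.card_singleton]
      have hw : pos (σ l) w = 2 := by
        rw [pos, hl]
        have : ({u, w} : Finset (Fin n)).filter (fun t => t ≤ w) = {u, w} := by
          apply Finset.filter_true_of_mem
          intro t ht
          simp only [Finset.mem_insert, Finset.mem_singleton] at ht
          rcases ht with rfl | rfl
          · exact hlt.le
          · exact le_rfl
        rw [this, Finset.card_pair huw]
      simp only [signExp, hu, hw]
      rw [← Finsupp.single_zero CellIndex.empty]
      congr 1
      ring
  | succ i =>
    have h2 : ∀ q ∈ removable σ, cellD k d H (i + 1)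
        (((-1) ^ signExp σ q.1 q.2 * X q.2 : MvPolynomial (Fin n) k) •
          cellVec k d H (i + 1) (del σ q.1 q.2)) = ∑ q' ∈ removable (del σ q.1 q.2),
        ((-1) ^ signExp σ q.1 q.2 * X q.2 * ((-1) ^ signExp (del σ q.1 q.2) q'.1 q'.2 * X q'.2) :
          MvPolynomial (Fin n) k) • cellVec k d H i (del (del σ q.1 q.2) q'.1 q'.2) := by
      intro q hq
      have hdim := cellDim_del hq
      have hd1 : cellDim σ = i + 1 + 1 := hσ.2
      rw [map_smul, cellD_cellVec k d H _ _ ⟨isCell_del hσ.1 hq, by omega⟩, Finset.smul_sum]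
      simp only [smul_smul]
    rw [Finset.sum_congr rfl h2, Finset.sum_sigma']
    refine Finset.sum_involution (fun q _ => ⟨q.2, q.1⟩) ?_ ?_ ?_ ?_
    · rintro ⟨q, q'⟩ hq
      rw [Finset.mem_sigma] at hq
      obtain ⟨h3, h4, h5⟩ := removable_swap hq.1 hq.2
      simp only
      rw [del_comm σ q'.1 q.1, ← add_smul]
      have := sign_cancel (A := MvPolynomial (Fin n) k) hq.1 h3 h5
      have e : ((-1) ^ signExp σ q.1 q.2 * X q.2 *
          ((-1) ^ signExp (del σ q.1 q.2) q'.1 q'.2 * X q'.2) +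
          (-1) ^ signExp σ q'.1 q'.2 * X q'.2 *
          ((-1) ^ signExp (del σ q'.1 q'.2) q.1 q.2 * X q.2) : MvPolynomial (Fin n) k) = 0 := by
        linear_combination (X q.2 * X q'.2) * this
      rw [e, zero_smul]
    · rintro ⟨q, q'⟩ hq _ h
      rw [Finset.mem_sigma] at hq
      simp only [Sigma.mk.injEq] at h
      exact (removable_swap hq.1 hq.2).2.2 h.1.symm
    · rintro ⟨q, q'⟩ hq
      rw [Finset.mem_sigma] at hq ⊢
      obtain ⟨h3, h4, _⟩ := removable_swap hq.1 hq.2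
      exact ⟨h3, h4⟩
    · rintro ⟨q, q'⟩ _
      rfl

/-! ### The two complexes, with their bases, degrees and augmentations -/

/-- The Koszul complex on the variables `x_v`, `v ∈ S`. -/
abbrev koszul (k : Type*) [Field k] {n : ℕ} (S : Finset (Fin n)) :
    ChainComplex (ModuleCat (MvPolynomial (Fin n) k)) ℕ :=
  freeComplex (KoszulIndex S) (koszulD k S) (koszulD_comp k S)

/-- The basis of the Koszul complex. -/
def koszulBasis (k : Type*) [Field k] {n : ℕ} (S : Finset (Fin n)) (i : ℕ) :
    Module.Basis (KoszulIndex S i) (MvPolynomial (Fin n) k) ((koszul k S).X i) :=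
  (Finsupp.basisSingleOne :
    Module.Basis (KoszulIndex S i) (MvPolynomial (Fin n) k)
      (KoszulIndex S i →₀ MvPolynomial (Fin n) k))

/-- The augmentation of the Koszul complex to `R / J`, sending `e_∅` to `1`. -/
def koszulAug (k : Type*) [Field k] {n : ℕ} (S : Finset (Fin n))
    (J : Ideal (MvPolynomial (Fin n) k)) :
    (koszul k S).X 0 →ₗ[MvPolynomial (Fin n) k] (MvPolynomial (Fin n) k ⧸ J) :=
  (Finsupp.linearCombination (MvPolynomial (Fin n) k)
    (fun _ : KoszulIndex S 0 => (1 : MvPolynomial (Fin n) k ⧸ J)) :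
    (KoszulIndex S 0 →₀ MvPolynomial (Fin n) k) →ₗ[MvPolynomial (Fin n) k] _)

/-- The cellular complex of the labelled complex `X_H`, augmented by the empty face. -/
abbrev homComplex (k : Type*) [Field k] {n : ℕ} (d : ℕ) (H : Finset (Finset (Fin n))) :
    ChainComplex (ModuleCat (MvPolynomial (Fin n) k)) ℕ :=
  freeComplex (CellIndex d H) (cellD k d H) (cellD_comp k d H)

/-- The basis of the cellular complex formed by the faces of `X_H`. -/
def cellBasis (k : Type*) [Field k] {n : ℕ} (d : ℕ) (H : Finset (Finset (Fin n))) (i : ℕ) :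
    Module.Basis (CellIndex d H i) (MvPolynomial (Fin n) k) ((homComplex k d H).X i) :=
  (Finsupp.basisSingleOne :
    Module.Basis (CellIndex d H i) (MvPolynomial (Fin n) k)
      (CellIndex d H i →₀ MvPolynomial (Fin n) k))

/-- The degree of a face is the exponent vector of its label; the empty face has degree zero. -/
def cellDeg {n : ℕ} (d : ℕ) (H : Finset (Finset (Fin n))) : ∀ i, CellIndex d H i → (Fin n →₀ ℕ)
  | 0, _ => 0
  | _ + 1, σ => cellLabel σ.sets

/-- The augmentation of the cellular complex to `R / I`, sending the empty face to `1`. -/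
def cellAug (k : Type*) [Field k] {n : ℕ} (d : ℕ) (H : Finset (Finset (Fin n)))
    (I : Ideal (MvPolynomial (Fin n) k)) :
    (homComplex k d H).X 0 →ₗ[MvPolynomial (Fin n) k] (MvPolynomial (Fin n) k ⧸ I) :=
  (Finsupp.linearCombination (MvPolynomial (Fin n) k)
    (fun _ : CellIndex d H 0 => (1 : MvPolynomial (Fin n) k ⧸ I)) :
    (CellIndex d H 0 →₀ MvPolynomial (Fin n) k) →ₗ[MvPolynomial (Fin n) k] _)

/-- The cell of the symbol `(m; α)`: its factor number `l` (counted from zero) consists of the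
element number `l` of `m` and of the elements of `α` between this one and the preceding element of
`m`, that is, of the elements of `m ∪ α` with exactly `l` elements of `m` below them. -/
def cellOf {n : ℕ} (d : ℕ) (m α : Finset (Fin n)) : Fin d → Finset (Fin n) :=
  fun l => (m ∪ α).filter fun j => (m.filter fun i => i < j).card = l

/-- The symbol `(m; α)` with `|α| = i`, as an element of the module in homological degree
`i + 1`. -/
def symb (k : Type*) [Field k] {n : ℕ} (d : ℕ) (H : Finset (Finset (Fin n))) (i : ℕ)
    (m α : Finset (Fin n)) : (homComplex k d H).X (i + 1) :=
  cellVec k d H i (cellOf d m α)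

/-! ### Mapping cones -/

/-- The map `R / (I : f) → R / I` induced by the multiplication by `f`. -/
def mulQuot {R : Type*} [CommRing R] (I : Ideal R) (f : R) :
    (R ⧸ I.colon {f}) →ₗ[R] (R ⧸ I) :=
  Submodule.mapQ (I.colon {f}) I (LinearMap.mulRight R f) fun r hr => by
    simpa using Submodule.mem_colon_singleton.1 hr

/-- One step of the iterated mapping cone: with `I = I_G`,
* the cellular complex of `X_G` is a minimal graded free resolution of `R / I`,
* the Koszul complex on the variables in `S` is a minimal graded free resolution of `R / (I : m)`,
* there is a chain map `ψ` between them that lifts the map `R / (I : m) → R / I` given by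
  multiplication by `m`, and an isomorphism from the mapping cone of `ψ` to the cellular complex of
  `X_{G'}`, which sends the basis element `e_α` of the Koszul complex to the symbol `(m; α)` and
  each face of `X_G` to the same face of `X_{G'}`. -/
def IsConeStep (k : Type*) [Field k] {n : ℕ} (d : ℕ) (G : Finset (Finset (Fin n)))
    (S m : Finset (Fin n)) (G' : Finset (Finset (Fin n))) : Prop :=
  IsMinimalGradedFreeResolution (edgeIdeal k G) (homComplex k d G) (cellBasis k d G)
    (cellDeg d G) (cellAug k d G (edgeIdeal k G)) ∧
  IsMinimalGradedFreeResolution ((edgeIdeal k G).colon {mon k m}) (koszul k S) (koszulBasis k S)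
    (fun _ α => expo α.1) (koszulAug k S ((edgeIdeal k G).colon {mon k m})) ∧
  ∃ ψ : koszul k S ⟶ homComplex k d G,
    (∀ x : (koszul k S).X 0, cellAug k d G (edgeIdeal k G) ((ψ.f 0).hom x) =
      mulQuot (edgeIdeal k G) (mon k m)
        (koszulAug k S ((edgeIdeal k G).colon {mon k m}) x)) ∧
    ∃ Φ : HomologicalComplex.homotopyCofiber ψ ≅ homComplex k d G',
      (∀ (i : ℕ) (α : KoszulIndex S i),
        (HomologicalComplex.homotopyCofiber.inlX ψ i (i + 1) rfl ≫ Φ.hom.f (i + 1)).hom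
          (koszulBasis k S i α) = symb k d G' i m α.1) ∧
      (HomologicalComplex.homotopyCofiber.inrX ψ 0 ≫ Φ.hom.f 0).hom (cellBasis k d G 0 .empty) =
        cellBasis k d G' 0 .empty ∧
      (∀ (i : ℕ) (σ : CellIndex d G (i + 1)),
        (HomologicalComplex.homotopyCofiber.inrX ψ (i + 1) ≫ Φ.hom.f (i + 1)).hom
          (cellBasis k d G (i + 1) σ) = cellVec k d G' i σ.sets)

end

end HomCone

open HomCone

namespace HomCone

/-! ### Exchange property of cointerval hypergraphs -/

/-! Only one consequence of cointervality is needed: an element of an edge other than its largest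
one may be lowered to any vertex above its predecessor (`IsCointerval.isExchange`). If the edge m is
lexicographically smaller than the edge m', their first difference yields v in m' \ m and p in m
such that m with p replaced by v is again an edge (`IsExchange.exists_isPart_of_lt`). Hence the
colon ideals are generated by variables (`IsExchange.colon_eq`), and set(m) consists of the
exchangeable elements.

The maxima of the factors of a cell form an edge m, and the remaining elements form a set α. These
are exchangeable, since replacing one maximum leads to another vertex of the cell. Conversely, every
vertex of the product attached to (m;α) is reached from m by changing the last coordinate and then
lowering the others one by one (`IsTop.isCell`). This is the bijection of symbols and cells.
Removing an element of α from (m;α) keeps m; removing a maximum p makes the next element j of its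
factor the new maximum, which gives (c(x_j m); α \ j). Up to even numbers, the exponents of the
cellular signs are positions in α, with an additional 1 in the second case. This is the formula for
the differential.

If m is the smallest edge, the cells of X_H are those of X_{H \ m} and the symbols (m;α)
(`IsLast.bijective`). The first part of the differential of (m;α) is minus the Koszul differential,
and the second part lies in X_{H \ m}. So the cellular complex is the cone of a comparison map, and
that this is a chain map follows from d² = 0 (`IsLast.comparison_comm`). Exactness follows by
induction on the number of edges (`exact_of_cone`, `koszul_exact`), where the lowest degree uses the
injectivity of R/(I:m) → R/I. -/

/-- A `d`-uniform hypergraph, `d ≥ 1`, in which every element `p` of an edge `m` other than the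
largest one may be replaced by a vertex `v` between `p` and its predecessor in `m`. -/
structure IsExchange {n : ℕ} (d : ℕ) (V : Finset (Fin n)) (H : Finset (Finset (Fin n))) :
    Prop where
  one_le : 1 ≤ d
  subset : ∀ m ∈ H, m ⊆ V
  card : ∀ m ∈ H, m.card = d
  exch : ∀ m ∈ H, ∀ v ∈ V, ∀ p ∈ m, ∀ q ∈ m, v < p → p < q → (∀ r ∈ m, r < p → r < v) →
    insert v (m.erase p) ∈ H

/-- The element `p` of `m` may be replaced by `j`, which lies between `p` and its predecessor. -/
def IsPart {n : ℕ} (H : Finset (Finset (Fin n))) (m : Finset (Fin n)) (p j : Fin n) : Prop :=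
  (∀ q ∈ m, q < p → q < j) ∧ j < p ∧ insert j (m.erase p) ∈ H

section

variable {n d : ℕ} {V : Finset (Fin n)} {H : Finset (Finset (Fin n))} {m m' : Finset (Fin n)}

/-- Induction through the layers. If p is the minimum of m, the inclusion of the p-layer in the
v-layer is the exchange; otherwise the exchange takes place in the layer of the minimum of m. -/
theorem IsCointerval.isExchange : ∀ {d : ℕ} {V : Finset (Fin n)} {H : Finset (Finset (Fin n))},
    IsCointerval d V H → IsExchange d V H
  | 0, _, _, h => h.elim
  | 1, V, H, h => by
    refine ⟨le_rfl, fun m hm => (h m hm).1, fun m hm => (h m hm).2, ?_⟩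
    intro m hm v _ p hp q hq _ hpq _
    exact absurd (Finset.card_le_one.1 (h m hm).2.le p hp q hq) hpq.ne
  | d + 2, V, H, ⟨h1, h2, h3⟩ => by
    refine ⟨by omega, fun m hm => (h1 m hm).1, fun m hm => (h1 m hm).2, ?_⟩
    intro m hm v hv p hp q hq hvp hpq hr
    have hne : m.Nonempty := ⟨p, hp⟩
    set a := m.min' hne with ha
    have ham : a ∈ m := Finset.min'_mem _ _
    have hle : ∀ x ∈ m, a ≤ x := fun x hx => Finset.min'_le _ _ hx
    have haV : a ∈ V := (h1 m hm).1 ham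
    have hlay : m.erase a ∈ layer H a := by
      simp only [layer, Finset.mem_filter, Finset.mem_univ, true_and, Finset.insert_erase ham,
        hm, and_true]
      intro w hw
      exact lt_of_le_of_ne (hle w (Finset.mem_of_mem_erase hw)) (Finset.ne_of_mem_erase hw).symm
    rcases eq_or_ne p a with rfl | hpa
    · have := h3 v hv _ haV hvp hlay
      simp only [layer, Finset.mem_filter] at this
      exact this.2.2
    · have hap : a < p := lt_of_le_of_ne (hle p hp) hpa.symm
      have hav : a < v := hr a ham hap
      have ih := (h2 a haV).isExchange.exch _ hlay v (by simp [hv, hav]) p (by simp [hpa, hp])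
        q (by simp [hq, (hap.trans hpq).ne']) hvp hpq
        (fun r hrm => hr r (Finset.mem_of_mem_erase hrm))
      simp only [layer, Finset.mem_filter] at ih
      have := ih.2.2
      rwa [Finset.insert_comm, Finset.erase_right_comm, Finset.insert_erase] at this
      simp [ham, hpa.symm]

/-! ### Squarefree exponent vectors and the lexicographic order -/

theorem expo_apply (e : Finset (Fin n)) (v : Fin n) : expo e v = if v ∈ e then 1 else 0 := by
  simp [expo, Finsupp.finsetSum_apply, Finsupp.single_apply]

theorem expo_le_expo {e e' : Finset (Fin n)} : expo e ≤ expo e' ↔ e ⊆ e' := by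
  constructor
  · intro h v hv
    have := h v
    rw [expo_apply, expo_apply, if_pos hv] at this
    by_contra hv'
    simp [hv'] at this
  · intro h v
    rw [expo_apply, expo_apply]
    split_ifs with h1 h2
    · exact le_rfl
    · exact absurd (h h1) h2
    · exact Nat.zero_le _
    · exact le_rfl

theorem expo_injective : Function.Injective (expo : Finset (Fin n) → _) := fun _ _ h =>
  subset_antisymm (expo_le_expo.1 h.le) (expo_le_expo.1 h.ge)

theorem lex_expo_lt : toLex (expo m) < toLex (expo m') ↔
    ∃ v, (∀ w < v, w ∈ m ↔ w ∈ m') ∧ v ∉ m ∧ v ∈ m' := by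
  rw [Finsupp.Lex.lt_iff]
  refine exists_congr fun v => and_congr (forall₂_congr fun w _ => ?_) ?_
  · simp only [ofLex_toLex, expo_apply]
    split_ifs with h1 h2 h2 <;> simp [h1, h2]
  · simp only [ofLex_toLex, expo_apply]
    split_ifs with h1 h2 h2 <;> simp [h1, h2]

theorem IsPart.notMem {p j : Fin n} (h : IsPart H m p j) : j ∉ m := fun hj =>
  lt_irrefl j (h.1 j hj h.2.1)

/-- The two sets agree below j, and only the new one contains j. So every exchange moves to an
earlier generator. -/
theorem lex_lt_exchange {p j : Fin n} (hj : j ∉ m) (hjp : j < p) :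
    toLex (expo m) < toLex (expo (insert j (m.erase p))) := by
  refine lex_expo_lt.2 ⟨j, fun w hw => ?_, hj, by simp⟩
  simp [hw.ne, (hw.trans hjp).ne]

/-- The source of linear quotients: v is the first place of difference, and p is the least element
of m above v. -/
theorem IsExchange.exists_isPart_of_lt (hH : IsExchange d V H) (hm : m ∈ H) (hm' : m' ∈ H)
    (h : toLex (expo m) < toLex (expo m')) :
    ∃ v ∈ m', v ∉ m ∧ ∃ p ∈ m, IsPart H m p v := by
  obtain ⟨v, hw, hvm, hvm'⟩ := lex_expo_lt.1 h
  refine ⟨v, hvm', hvm, ?_⟩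
  have hcard : m.card = m'.card := (hH.card m hm).trans (hH.card m' hm').symm
  -- Otherwise m would lie below v, hence inside m' without v, which has fewer elements.
  have hne : (m.filter fun p => v < p).Nonempty := by
    by_contra hemp
    rw [Finset.not_nonempty_iff_eq_empty, Finset.filter_eq_empty_iff] at hemp
    have hsub : m ⊆ m'.erase v := by
      intro x hx
      have hxv : x < v := lt_of_le_of_ne (not_lt.1 (hemp hx)) (fun e => hvm (e ▸ hx))
      exact Finset.mem_erase.2 ⟨hxv.ne, (hw x hxv).1 hx⟩
    have := Finset.card_le_card hsub
    rw [Finset.card_erase_of_mem hvm'] at this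
    have := Finset.card_pos.2 ⟨v, hvm'⟩
    omega
  set p := (m.filter fun p => v < p).min' hne with hp
  have hpm := Finset.min'_mem _ hne
  rw [← hp, Finset.mem_filter] at hpm
  have hmin : ∀ q ∈ m, q < p → q < v := by
    intro q hq hqp
    by_contra hvq
    have hvq' : v < q := lt_of_le_of_ne (not_lt.1 hvq) (fun e => hvm (e ▸ hq))
    exact absurd (Finset.min'_le _ q (Finset.mem_filter.2 ⟨hq, hvq'⟩)) (not_le.2 hqp)
  refine ⟨p, hpm.1, hmin, hpm.2, ?_⟩
  by_cases hex : ∃ q ∈ m, p < q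
  · obtain ⟨q, hq, hpq⟩ := hex
    exact hH.exch m hm v (hH.subset m' hm' hvm') p hpm.1 q hq hpm.2 hpq hmin
  -- Here p is the largest element of m, where no exchange is available; but then the new set lies
  -- in m' and equals it by cardinality.
  · push Not at hex
    have hsub : insert v (m.erase p) ⊆ m' := by
      intro x hx
      rcases Finset.mem_insert.1 hx with rfl | hx
      · exact hvm'
      · obtain ⟨hxp, hxm⟩ := Finset.mem_erase.1 hx
        exact (hw x (hmin x hxm (lt_of_le_of_ne (hex x hxm) hxp))).1 hxm
    have : insert v (m.erase p) = m' := by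
      apply Finset.eq_of_subset_of_card_le hsub
      rw [Finset.card_insert_of_notMem (fun h => hvm (Finset.mem_of_mem_erase h)),
        Finset.card_erase_of_mem hpm.1]
      omega
    rwa [this]

/-! ### Membership in monomial ideals -/

variable (k : Type*) [Field k]

theorem mem_edgeIdeal {f : MvPolynomial (Fin n) k} :
    f ∈ edgeIdeal k H ↔ ∀ u ∈ f.support, ∃ m ∈ H, expo m ≤ u := by
  have : mon k '' (H : Set (Finset (Fin n))) =
      (fun s => monomial s (1 : k)) '' (expo '' (H : Set (Finset (Fin n)))) := by
    rw [Set.image_image]; rfl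
  rw [edgeIdeal, this, mem_ideal_span_monomial_image]
  simp

theorem mon_mem_edgeIdeal {e : Finset (Fin n)} :
    mon k e ∈ edgeIdeal k H ↔ ∃ m ∈ H, m ⊆ e := by
  classical
  rw [mem_edgeIdeal, mon, support_monomial, if_neg one_ne_zero]
  simp [expo_le_expo]

/-- Multiplying by a monomial only shifts supports, so membership can be tested on the monomials of
f one at a time. -/
theorem mem_colon_edgeIdeal {f : MvPolynomial (Fin n) k} :
    f ∈ (edgeIdeal k H).colon {mon k m} ↔
      ∀ u ∈ f.support, ∃ m' ∈ H, expo m' ≤ u + expo m := by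
  rw [Submodule.mem_colon_singleton, smul_eq_mul, mem_edgeIdeal, mon]
  constructor
  · intro h u hu
    refine h _ ?_
    rw [mem_support_iff, coeff_mul_monomial, mul_one]
    exact mem_support_iff.1 hu
  · intro h u hu
    rw [mem_support_iff, coeff_mul_monomial'] at hu
    split_ifs at hu with hle
    · obtain ⟨m', hm', hle'⟩ := h (u - expo m) (mem_support_iff.2 (by simpa using hu))
      exact ⟨m', hm', by rwa [tsub_add_cancel_of_le hle] at hle'⟩
    · exact absurd rfl hu

/-! ### Colon ideals and linear quotients -/

theorem mem_of_expo_le_add {u : Fin n →₀ ℕ} (h : expo m' ≤ u + expo m) {v : Fin n} (hv : v ∈ m')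
    (hvm : v ∉ m) : u v ≠ 0 := by
  have := h v
  rw [Finsupp.add_apply, expo_apply, expo_apply, if_pos hv, if_neg hvm] at this
  omega

theorem IsExchange.mem_linSet (hH : IsExchange d V H) (hm : m ∈ H) {v : Fin n} :
    v ∈ linSet k H m ↔ ∃ p ∈ m, IsPart H m p v := by
  simp only [linSet, Finset.mem_filter, Finset.mem_univ, true_and]
  rw [mem_colon_edgeIdeal, support_X]
  simp only [Finset.mem_singleton, forall_eq]
  constructor
  · rintro ⟨m', hm', hle⟩
    rw [before, Finset.mem_filter] at hm'
    obtain ⟨v', hv', hv'm, h⟩ := hH.exists_isPart_of_lt hm hm'.1 hm'.2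
    -- The element v' of m' lies outside m, so it divides x_v m only through the factor x_v.
    have := mem_of_expo_le_add hle hv' hv'm
    rw [Finsupp.single_apply] at this
    obtain rfl : v = v' := by
      by_contra hne
      simp [hne] at this
    exact h
  · rintro ⟨p, hp, h⟩
    refine ⟨_, Finset.mem_filter.2 ⟨h.2.2, lex_lt_exchange h.notMem h.2.1⟩, fun w => ?_⟩
    rw [Finsupp.add_apply, expo_apply, expo_apply, Finsupp.single_apply]
    by_cases h1 : v = w
    · split_ifs <;> simp
    · by_cases h2 : w ∈ m
      · split_ifs <;> simp
      · simp [h1, h2, Ne.symm h1]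

/-- A monomial that carries m into the ideal is divisible by the variable found by comparing m with
the earlier generator involved. -/
theorem IsExchange.colon_eq (hH : IsExchange d V H) (hm : m ∈ H) :
    (edgeIdeal k (before H m)).colon {mon k m} =
      Ideal.span (X '' (linSet k H m : Set (Fin n))) := by
  ext f
  rw [mem_ideal_span_X_image]
  constructor
  · intro h u hu
    obtain ⟨m', hm', hle⟩ := (mem_colon_edgeIdeal k).1 h u hu
    rw [before, Finset.mem_filter] at hm'
    obtain ⟨v, hv, hvm, h⟩ := hH.exists_isPart_of_lt hm hm'.1 hm'.2
    exact ⟨v, (hH.mem_linSet k hm).2 h, mem_of_expo_le_add hle hv hvm⟩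
  · intro h
    rw [← mem_ideal_span_X_image] at h
    refine Ideal.span_le.2 ?_ h
    rintro _ ⟨v, hv, rfl⟩
    simpa [linSet] using hv

/-- All edges have d elements, so a squarefree monomial of degree d in the ideal is itself a
generator. -/
theorem IsExchange.isInPart_iff (hH : IsExchange d V H) (hm : m ∈ H) {p j : Fin n} (hp : p ∈ m) :
    IsInPart k H m p j ↔ IsPart H m p j := by
  unfold IsInPart IsPart
  refine and_congr_right fun h1 => and_congr_right fun h2 => ?_
  rw [mon_mem_edgeIdeal]
  constructor
  · rintro ⟨m', hm', hsub⟩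
    have hj : j ∉ m.erase p := fun hj => lt_irrefl j (h1 j (Finset.mem_of_mem_erase hj) h2)
    have : m' = insert j (m.erase p) := by
      apply Finset.eq_of_subset_of_card_le hsub
      rw [Finset.card_insert_of_notMem hj, Finset.card_erase_add_one hp, hH.card m hm,
        hH.card m' hm']
    rwa [← this]
  · intro h
    exact ⟨_, h, subset_rfl⟩

/-- Exchange properties pass to the sets of edges that are closed under passing to lexicographically
larger edges. -/
theorem IsExchange.of_upper (hH : IsExchange d V H) {G : Finset (Finset (Fin n))} (hG : G ⊆ H)
    (hup : ∀ m ∈ G, ∀ m' ∈ H, toLex (expo m) < toLex (expo m') → m' ∈ G) : IsExchange d V G where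
  one_le := hH.one_le
  subset m hm := hH.subset m (hG hm)
  card m hm := hH.card m (hG hm)
  exch m hm v hv p hp q hq hvp hpq hr := hup m hm _
    (hH.exch m (hG hm) v hv p hp q hq hvp hpq hr)
    (lex_lt_exchange (fun h => lt_irrefl v (hr v h hvp)) hvp)

end

end HomCone

namespace HomCone

/-! ### Cells and their top vertices -/

/-- `σ_1 < ⋯ < σ_d`, and `u l` is the largest element of `σ l`. -/
structure IsTop {n d : ℕ} (σ : Fin d → Finset (Fin n)) (u : Fin d → Fin n) : Prop where
  ordered : ∀ l l', l < l' → ∀ x ∈ σ l, ∀ y ∈ σ l', x < y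
  mem : ∀ l, u l ∈ σ l
  le : ∀ l, ∀ x ∈ σ l, x ≤ u l

section

variable {n d : ℕ} {V : Finset (Fin n)} {H : Finset (Finset (Fin n))} {m α : Finset (Fin n)}
  {σ : Fin d → Finset (Fin n)} {u : Fin d → Fin n}

theorem IsTop.strictMono_of_mem (h : IsTop σ u) {w : Fin d → Fin n} (hw : ∀ l, w l ∈ σ l) :
    StrictMono w := fun l l' hl => h.ordered l l' hl _ (hw l) _ (hw l')

theorem IsTop.strictMono (h : IsTop σ u) : StrictMono u := h.strictMono_of_mem h.mem

theorem IsTop.index_unique (h : IsTop σ u) {l l' : Fin d} {x : Fin n} (hx : x ∈ σ l)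
    (hx' : x ∈ σ l') : l = l' := by
  rcases lt_trichotomy l l' with hl | hl | hl
  · exact absurd (h.ordered l l' hl x hx x hx') (lt_irrefl x)
  · exact hl
  · exact absurd (h.ordered l' l hl x hx' x hx) (lt_irrefl x)

/-- Earlier factors lie entirely below x, whereas the maximum of the same or of a later factor does
not. -/
theorem IsTop.lt_iff (h : IsTop σ u) {l l' : Fin d} {x : Fin n} (hx : x ∈ σ l) :
    u l' < x ↔ l' < l := by
  constructor
  · intro hlt
    by_contra hl
    rcases (not_lt.1 hl).eq_or_lt with rfl | hl
    · exact absurd (h.le l x hx) (not_le.2 hlt)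
    · exact absurd (h.ordered l l' hl x hx _ (h.mem l')) (not_lt.2 hlt.le)
  · intro hl
    exact h.ordered l' l hl _ (h.mem l') x hx

theorem card_filter_image_lt (hu : StrictMono u) {x : Fin n} {l : Fin d}
    (h : ∀ l', u l' < x ↔ l' < l) : ((Finset.univ.image u).filter fun i => i < x).card = l := by
  have : (Finset.univ.image u).filter (fun i => i < x) = (Finset.Iio l).image u := by
    ext y
    simp only [Finset.mem_filter, Finset.mem_image, Finset.mem_univ, true_and, Finset.mem_Iio]
    constructor
    · rintro ⟨⟨l', rfl⟩, hl'⟩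
      exact ⟨l', (h l').1 hl', rfl⟩
    · rintro ⟨l', hl', rfl⟩
      exact ⟨⟨l', rfl⟩, (h l').2 hl'⟩
  rw [this, Finset.card_image_of_injective _ hu.injective, Fin.card_Iio]

/-- The number of maxima below an element is the index of its factor, so a cell is recovered from
its maxima and the union of its factors. -/
theorem IsTop.cellOf_eq (h : IsTop σ u) (hα : Finset.univ.image u ∪ α = Finset.univ.biUnion σ) :
    cellOf d (Finset.univ.image u) α = σ := by
  funext l
  ext x
  rw [cellOf, hα, Finset.mem_filter]
  simp only [Finset.mem_biUnion, Finset.mem_univ, true_and]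
  constructor
  · rintro ⟨⟨l', hx⟩, hc⟩
    rw [card_filter_image_lt h.strictMono fun _ => h.lt_iff hx] at hc
    rwa [← Fin.ext hc]
  · intro hx
    exact ⟨⟨l, hx⟩, card_filter_image_lt h.strictMono fun _ => h.lt_iff hx⟩

/-- Any point above an element of m has a larger count of elements of m below it, so each element of
m is the maximum of its factor. Elements of α above all of m have count d and occur in no factor, so
α may be arbitrary. -/
theorem isTop_cellOf (hm : m.card = d) (α : Finset (Fin n)) :
    IsTop (cellOf d m α) (m.orderEmbOfFin hm) := by
  have hmem : ∀ l, ((m.filter fun i => i < m.orderEmbOfFin hm l).card = l) := by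
    intro l
    have := card_filter_image_lt (m.orderEmbOfFin hm).strictMono
      (fun _ => (m.orderEmbOfFin hm).lt_iff_lt (b := l))
    rwa [Finset.image_orderEmbOfFin_univ] at this
  refine ⟨?_, fun l => ?_, ?_⟩
  · intro l l' hl x hx y hy
    rw [cellOf, Finset.mem_filter] at hx hy
    by_contra hxy
    have : (m.filter fun i => i < y).card ≤ (m.filter fun i => i < x).card :=
      Finset.card_le_card (Finset.monotone_filter_right _ fun i _ hi => hi.trans_le (not_lt.1 hxy))
    rw [hx.2, hy.2] at this
    exact absurd hl (not_lt.2 this)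
  · rw [cellOf, Finset.mem_filter]
    exact ⟨Finset.mem_union_left _ (Finset.orderEmbOfFin_mem _ _ _), hmem l⟩
  · intro l x hx
    rw [cellOf, Finset.mem_filter] at hx
    by_contra hlt
    rw [not_le] at hlt
    have : (m.filter fun i => i < m.orderEmbOfFin hm l).card < (m.filter fun i => i < x).card := by
      apply Finset.card_lt_card
      refine Finset.ssubset_iff_of_subset (Finset.monotone_filter_right _
        fun i _ hi => hi.trans hlt) |>.2 ⟨m.orderEmbOfFin hm l, ?_, ?_⟩
      · exact Finset.mem_filter.2 ⟨Finset.orderEmbOfFin_mem _ _ _, hlt⟩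
      · simp
    rw [hmem, hx.2] at this
    exact lt_irrefl _ this

theorem biUnion_cellOf (hm : m.card = d) (hα : ∀ a ∈ α, ∃ p ∈ m, a < p) :
    Finset.univ.biUnion (cellOf d m α) = m ∪ α := by
  ext x
  simp only [Finset.mem_biUnion, Finset.mem_univ, true_and, cellOf, Finset.mem_filter]
  constructor
  · rintro ⟨l, hx, _⟩
    exact hx
  · intro hx
    have : ∃ p ∈ m, x ≤ p := by
      rcases Finset.mem_union.1 hx with hx | hx
      · exact ⟨x, hx, le_rfl⟩
      · obtain ⟨p, hp, hlt⟩ := hα x hx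
        exact ⟨p, hp, hlt.le⟩
    obtain ⟨p, hp, hle⟩ := this
    refine ⟨⟨(m.filter fun i => i < x).card, ?_⟩, hx, rfl⟩
    rw [← hm]
    apply Finset.card_lt_card
    refine Finset.ssubset_iff_of_subset (Finset.filter_subset _ _) |>.2 ⟨p, hp, ?_⟩
    simp [hle]

theorem image_update {u : Fin d → Fin n} (hu : Function.Injective u) (l : Fin d) (x : Fin n) :
    Finset.univ.image (Function.update u l x) = insert x ((Finset.univ.image u).erase (u l)) := by
  ext y
  simp only [Finset.mem_image, Finset.mem_univ, true_and, Finset.mem_insert, Finset.mem_erase]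
  constructor
  · rintro ⟨l', rfl⟩
    rcases eq_or_ne l' l with rfl | hl
    · simp
    · rw [Function.update_of_ne hl]
      exact Or.inr ⟨hu.ne hl, l', rfl⟩
  · rintro (rfl | ⟨hy, l', rfl⟩)
    · exact ⟨l, by simp⟩
    · refine ⟨l', ?_⟩
      rw [Function.update_of_ne]
      rintro rfl
      exact hy rfl

/-- A vertex v is reached from the maxima u: the last coordinate is changed first, by `hlast`; then
the others are lowered one at a time, the last coordinate serving as the larger element that the
exchange property asks for. -/
theorem IsTop.isCell (h : IsTop σ u) (hH : IsExchange d V H) (hV : ∀ l, σ l ⊆ V) (l₀ : Fin d)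
    (hl₀ : ∀ l, l ≤ l₀)
    (hlast : ∀ x ∈ σ l₀, Finset.univ.image (Function.update u l₀ x) ∈ H) : IsCell d H σ := by
  refine ⟨fun l => ⟨u l, h.mem l⟩, h.ordered, fun v hv => ?_⟩
  -- The coordinates in s have already been changed, and the last one always counts as changed.
  have key : ∀ s : Finset (Fin d),
      Finset.univ.image (fun l => if l ∈ s ∨ l = l₀ then v l else u l) ∈ H := by
    intro s
    induction s using Finset.induction_on with
    | empty =>
      convert hlast (v l₀) (hv l₀) using 2
      funext l
      rcases eq_or_ne l l₀ with rfl | hl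
      · simp
      · simp [hl]
    | insert l s hl ih =>
      set w : Fin d → Fin n := fun l => if l ∈ s ∨ l = l₀ then v l else u l with hw
      have hupd : (fun l' => if l' ∈ insert l s ∨ l' = l₀ then v l' else u l') =
          Function.update w l (v l) := by
        funext l'
        rcases eq_or_ne l' l with rfl | hl'
        · simp
        · simp [hl', hw]
      rw [hupd]
      rcases eq_or_ne (w l) (v l) with he | he
      · rwa [← he, Function.update_eq_self]
      · have hll₀ : l ≠ l₀ := by
          rintro rfl
          simp [hw] at he
        have hwl : w l = u l := by simp [hw, hl, hll₀]
        have hwσ : ∀ l, w l ∈ σ l := by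
          intro l
          simp only [hw]
          split_ifs
          · exact hv l
          · exact h.mem l
        have hmono := h.strictMono_of_mem hwσ
        rw [image_update hmono.injective]
        refine hH.exch _ ih (v l) (hV l (hv l)) (w l) (by simp) (w l₀) (by simp) ?_
          (hmono (lt_of_le_of_ne (hl₀ l) hll₀)) ?_
        · rw [hwl] at he ⊢
          exact lt_of_le_of_ne (h.le l _ (hv l)) he.symm
        · intro r hr hlt
          obtain ⟨l', -, rfl⟩ := Finset.mem_image.1 hr
          exact h.ordered l' l (hmono.lt_iff_lt.1 hlt) _ (hwσ l') _ (hv l)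
  simpa using key Finset.univ

theorem IsCell.exists_isTop (hσ : IsCell d H σ) : ∃ u, IsTop σ u :=
  ⟨fun l => (σ l).max' (hσ.1 l), hσ.2.1, fun _ => Finset.max'_mem _ _,
    fun _ _ hx => Finset.le_max' _ _ hx⟩

/-- Replacing the maximum of one factor by x leads to another vertex of the same cell, which is an
edge. -/
theorem IsTop.isPart (h : IsTop σ u) (hσ : IsCell d H σ) {l : Fin d} {x : Fin n} (hx : x ∈ σ l)
    (hne : x ≠ u l) : IsPart H (Finset.univ.image u) (u l) x := by
  refine ⟨?_, lt_of_le_of_ne (h.le l x hx) hne, ?_⟩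
  · intro q hq hlt
    obtain ⟨l', -, rfl⟩ := Finset.mem_image.1 hq
    exact (h.lt_iff hx).2 (h.strictMono.lt_iff_lt.1 hlt)
  · rw [← image_update h.strictMono.injective]
    refine hσ.2.2 _ fun l' => ?_
    rcases eq_or_ne l' l with rfl | hl
    · simpa
    · simpa [hl] using h.mem l'

theorem IsTop.card_biUnion (h : IsTop σ u) (s : Finset (Fin d)) :
    (s.biUnion σ).card = ∑ l ∈ s, (σ l).card := by
  apply Finset.card_biUnion
  intro l _ l' _ hne
  rw [Function.onFun, Finset.disjoint_left]
  intro x hx hx'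
  exact hne (h.index_unique hx hx')

theorem IsTop.cellDim_add (h : IsTop σ u) :
    cellDim σ + d = (Finset.univ.biUnion σ).card := by
  rw [h.card_biUnion, cellDim]
  have : ∀ l ∈ Finset.univ, (σ l).card = ((σ l).card - 1) + 1 := fun l _ => by
    have := Finset.card_pos.2 ⟨u l, h.mem l⟩
    omega
  rw [Finset.sum_congr rfl this, Finset.sum_add_distrib]
  simp

/-! ### The correspondence between symbols and cells -/

/-- The elements of `α` may be exchanged for elements of `m`; this means that `α ⊆ set(m)`. -/
def IsLinear (H : Finset (Finset (Fin n))) (m α : Finset (Fin n)) : Prop :=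
  ∀ a ∈ α, ∃ p ∈ m, IsPart H m p a

theorem IsExchange.isLinear_iff (k : Type*) [Field k] (hH : IsExchange d V H) (hm : m ∈ H) :
    IsLinear H m α ↔ α ⊆ linSet k H m :=
  forall₂_congr fun _ _ => (hH.mem_linSet k hm).symm

theorem IsLinear.exists_lt (h : IsLinear H m α) : ∀ a ∈ α, ∃ p ∈ m, a < p := fun a ha =>
  let ⟨p, hp, hpa⟩ := h a ha
  ⟨p, hp, hpa.2.1⟩

theorem IsLinear.disjoint (h : IsLinear H m α) : Disjoint m α :=
  Finset.disjoint_right.2 fun a ha =>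
    let ⟨_, _, hpa⟩ := h a ha
    hpa.notMem

theorem IsLinear.mono (h : IsLinear H m α) {β : Finset (Fin n)} (hβ : β ⊆ α) : IsLinear H m β :=
  fun a ha => h a (hβ ha)

/-- The elements of m below a are those below p, so a and p have the same count. -/
theorem IsPart.mem_cellOf {p a : Fin n} (h : IsPart H m p a) (ha : a ∈ α) {l : Fin d} :
    a ∈ cellOf d m α l ↔ p ∈ cellOf d m α l ∨ p ∉ m ∪ α ∧ (m.filter fun i => i < p).card = l := by
  have : m.filter (fun i => i < a) = m.filter fun i => i < p :=
    Finset.filter_congr fun q hq => ⟨fun hqa => hqa.trans h.2.1, fun hqp => h.1 q hq hqp⟩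
  simp only [cellOf, Finset.mem_filter, this, Finset.mem_union_right m ha, true_and]
  tauto

/-- `IsTop.isCell` reduces the claim to the last factor. An element of α there shares its factor
with the element p it may replace, so p is the maximum of m. -/
theorem IsExchange.isCell_cellOf (hH : IsExchange d V H) (hm : m ∈ H) (hα : IsLinear H m α) :
    IsCell d H (cellOf d m α) := by
  have hc := hH.card m hm
  have htop := isTop_cellOf hc α
  have hd := hH.one_le
  have himg := Finset.image_orderEmbOfFin_univ m hc
  refine htop.isCell hH ?_ ⟨d - 1, by omega⟩ (fun l => Fin.le_def.2 (by dsimp only; omega)) ?_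
  · intro l x hx
    rw [cellOf, Finset.mem_filter] at hx
    rcases Finset.mem_union.1 hx.1 with hx | hx
    · exact hH.subset m hm hx
    · obtain ⟨p, -, -, -, h⟩ := hα x hx
      exact hH.subset _ h (Finset.mem_insert_self _ _)
  · intro x hx
    set l₀ : Fin d := ⟨d - 1, by omega⟩
    rw [image_update htop.strictMono.injective, himg]
    have hxu := (Finset.mem_filter.1 hx).1
    rcases Finset.mem_union.1 hxu with hxm | hxα
    · rw [← himg] at hxm
      obtain ⟨l, -, rfl⟩ := Finset.mem_image.1 hxm
      obtain rfl := htop.index_unique hx (htop.mem l)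
      rwa [Finset.insert_erase (Finset.orderEmbOfFin_mem _ _ _)]
    · obtain ⟨p, hp, hpart⟩ := hα x hxα
      rcases (hpart.mem_cellOf hxα).1 hx with hpl | hpl
      · rw [← himg] at hp
        obtain ⟨l, -, rfl⟩ := Finset.mem_image.1 hp
        obtain rfl := htop.index_unique hpl (htop.mem l)
        exact hpart.2.2
      · exact absurd (Finset.mem_union_left _ hp) hpl.1

theorem IsExchange.cellDim_cellOf (hH : IsExchange d V H) (hm : m ∈ H) (hα : IsLinear H m α) :
    cellDim (cellOf d m α) = α.card := by
  have := (isTop_cellOf (hH.card m hm) α).cellDim_add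
  rw [biUnion_cellOf (hH.card m hm) hα.exists_lt, Finset.card_union_of_disjoint hα.disjoint,
    hH.card m hm] at this
  omega

/-- Every cell comes from a symbol. -/
theorem IsTop.exists_symbol (h : IsTop σ u) (hσ : IsCell d H σ) :
    ∃ m ∈ H, ∃ α, m = Finset.univ.image u ∧ α = Finset.univ.biUnion σ \ m ∧
      IsLinear H m α ∧ cellOf d m α = σ := by
  refine ⟨_, hσ.2.2 u h.mem, _, rfl, rfl, ?_, ?_⟩
  · intro a ha
    rw [Finset.mem_sdiff, Finset.mem_biUnion] at ha
    obtain ⟨⟨l, -, hl⟩, hne⟩ := ha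
    refine ⟨u l, by simp, h.isPart hσ hl ?_⟩
    rintro rfl
    exact hne (by simp)
  · apply h.cellOf_eq
    rw [Finset.union_sdiff_of_subset]
    intro x hx
    obtain ⟨l, -, rfl⟩ := Finset.mem_image.1 hx
    exact Finset.mem_biUnion.2 ⟨l, Finset.mem_univ l, h.mem l⟩

theorem IsTop.eq_of_isTop {u' : Fin d → Fin n} (h : IsTop σ u) (h' : IsTop σ u') : u = u' :=
  funext fun l => le_antisymm (h'.le l _ (h.mem l)) (h.le l _ (h'.mem l))

/-- The cell determines m as the set of its maxima, and α as the rest of the union of its factors.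
-/
theorem cellOf_injective {m' α' : Finset (Fin n)} (hm : m.card = d) (hm' : m'.card = d)
    (hα : IsLinear H m α) (hα' : IsLinear H m' α') (h : cellOf d m α = cellOf d m' α') :
    m = m' ∧ α = α' := by
  have hu := (isTop_cellOf hm α).eq_of_isTop (h ▸ isTop_cellOf hm' α')
  have hmm : m = m' := by
    rw [← Finset.image_orderEmbOfFin_univ m hm, hu, Finset.image_orderEmbOfFin_univ]
  refine ⟨hmm, ?_⟩
  have hun : m ∪ α = m' ∪ α' := by
    rw [← biUnion_cellOf hm hα.exists_lt, h, biUnion_cellOf hm' hα'.exists_lt]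
  have e1 := Finset.union_sdiff_cancel_left hα.disjoint
  rw [hun, hmm, Finset.union_sdiff_cancel_left hα'.disjoint] at e1
  exact e1.symm

theorem IsExchange.bijOn_cellOf (hH : IsExchange d V H) (k : Type*) [Field k] (i : ℕ) :
    Set.BijOn (fun s : Finset (Fin n) × Finset (Fin n) => cellOf d s.1 s.2)
      {s | s.1 ∈ H ∧ s.2 ⊆ linSet k H s.1 ∧ s.2.card = i}
      {σ | IsCell d H σ ∧ cellDim σ = i} := by
  refine ⟨?_, ?_, ?_⟩
  · rintro ⟨m, α⟩ ⟨hm, hα, hc⟩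
    have hα := (hH.isLinear_iff k hm).2 hα
    exact ⟨hH.isCell_cellOf hm hα, (hH.cellDim_cellOf hm hα).trans hc⟩
  · rintro ⟨m, α⟩ ⟨hm, hα, -⟩ ⟨m', α'⟩ ⟨hm', hα', -⟩ h
    obtain ⟨h1, h2⟩ := cellOf_injective (hH.card m hm) (hH.card m' hm')
      ((hH.isLinear_iff k hm).2 hα) ((hH.isLinear_iff k hm').2 hα') h
    exact Prod.ext h1 h2
  · rintro σ ⟨hσ, hd⟩
    obtain ⟨u, hu⟩ := hσ.exists_isTop
    obtain ⟨m, hm, α, -, -, hα, rfl⟩ := hu.exists_symbol hσ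
    refine ⟨(m, α), ⟨hm, (hH.isLinear_iff k hm).1 hα, ?_⟩, rfl⟩
    rw [← hH.cellDim_cellOf hm hα, hd]

/-! ### Facets of cells -/

theorem IsTop.biUnion_del (h : IsTop σ u) {l : Fin d} {v : Fin n} (hv : v ∈ σ l) :
    Finset.univ.biUnion (del σ l v) = (Finset.univ.biUnion σ).erase v := by
  ext x
  simp only [Finset.mem_biUnion, Finset.mem_univ, true_and, Finset.mem_erase]
  constructor
  · rintro ⟨l', hx⟩
    refine ⟨?_, l', del_subset _ _ _ _ hx⟩
    rintro rfl
    obtain rfl := h.index_unique hv (del_subset _ _ _ _ hx)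
    simp [del] at hx
  · rintro ⟨hne, l', hx⟩
    refine ⟨l', ?_⟩
    rcases eq_or_ne l' l with rfl | hl
    · simp [del, hne, hx]
    · simpa [del, hl] using hx

theorem IsTop.del_of_ne (h : IsTop σ u) {l : Fin d} {v : Fin n} (hv : v ≠ u l) :
    IsTop (del σ l v) u := by
  refine ⟨fun l' l'' hl x hx y hy => h.ordered l' l'' hl x (del_subset _ _ _ _ hx) y
    (del_subset _ _ _ _ hy), fun l' => ?_, fun l' x hx => h.le l' x (del_subset _ _ _ _ hx)⟩
  rcases eq_or_ne l' l with rfl | hl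
  · simp [del, hv.symm, h.mem]
  · simpa [del, hl] using h.mem l'

theorem IsTop.del_top (h : IsTop σ u) {l : Fin d} {j : Fin n} (hj : j ∈ σ l) (hju : j ≠ u l)
    (hmax : ∀ x ∈ σ l, x ≠ u l → x ≤ j) :
    IsTop (del σ l (u l)) (Function.update u l j) := by
  refine ⟨fun l' l'' hl x hx y hy => h.ordered l' l'' hl x (del_subset _ _ _ _ hx) y
    (del_subset _ _ _ _ hy), fun l' => ?_, fun l' x hx => ?_⟩
  · rcases eq_or_ne l' l with rfl | hl
    · simp [del, hju, hj]
    · simpa [del, hl] using h.mem l'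
  · rcases eq_or_ne l' l with rfl | hl
    · simp only [del, Function.update_self, Finset.mem_erase] at hx ⊢
      exact hmax x hx.2 hx.1
    · simp only [del, Function.update_of_ne hl] at hx ⊢
      exact h.le l' x hx

/-- The maxima stay the same and the union loses v. -/
theorem del_cellOf_of_mem_right (hm : m.card = d) (hα : IsLinear H m α) {l : Fin d} {v : Fin n}
    (hv : v ∈ α) (hvl : v ∈ cellOf d m α l) : del (cellOf d m α) l v = cellOf d m (α.erase v) := by
  have htop := isTop_cellOf hm α
  have himg := Finset.image_orderEmbOfFin_univ m hm
  have hvm : v ∉ m := Finset.disjoint_right.1 hα.disjoint hv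
  have := (htop.del_of_ne (l := l) (v := v) (fun e => hvm (e ▸ Finset.orderEmbOfFin_mem _ _ _))
    ).cellOf_eq (α := α.erase v)
    (by rw [htop.biUnion_del hvl, biUnion_cellOf hm hα.exists_lt, himg, Finset.erase_union_distrib,
      Finset.erase_eq_of_notMem hvm])
  rw [himg] at this
  exact this.symm

/-- With p removed, j becomes the maximum of its factor and so passes from α to the edge. -/
theorem del_cellOf_of_mem_left (hm : m.card = d) (hα : IsLinear H m α) {l : Fin d} {p j : Fin n}
    (hp : p ∈ m) (hpl : p ∈ cellOf d m α l) (hj : j ∈ cellOf d m α l) (hjp : j ≠ p)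
    (hmax : ∀ x ∈ cellOf d m α l, x ≠ p → x ≤ j) :
    del (cellOf d m α) l p = cellOf d (insert j (m.erase p)) (α.erase j) := by
  have htop := isTop_cellOf hm α
  have himg := Finset.image_orderEmbOfFin_univ m hm
  obtain ⟨l', -, rfl⟩ := Finset.mem_image.1 (himg.symm ▸ hp)
  obtain rfl := htop.index_unique hpl (htop.mem l')
  have hpα : m.orderEmbOfFin hm l ∉ α := Finset.disjoint_left.1 hα.disjoint hp
  have := (htop.del_top hj hjp hmax).cellOf_eq (α := α.erase j) (by
    rw [htop.biUnion_del hpl, biUnion_cellOf hm hα.exists_lt,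
      image_update htop.strictMono.injective, himg]
    have hju := (Finset.mem_filter.1 hj).1
    ext x
    simp only [Finset.mem_union, Finset.mem_insert, Finset.mem_erase] at hju ⊢
    rcases eq_or_ne x j with rfl | hx
    · simp [hju, hjp]
    · rcases eq_or_ne x (m.orderEmbOfFin hm l) with rfl | hx'
      · simp [hpα, hx]
      · simp [hx, hx'])
  rw [image_update htop.strictMono.injective, himg] at this
  exact this.symm

/-- The earlier factors lie below v; together with the position of v in its own factor they count
all elements of the cell up to v. -/
theorem IsTop.signExp_eq (h : IsTop σ u) {l : Fin d} {v : Fin n} (hv : v ∈ σ l) :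
    signExp σ l v = l + pos (Finset.univ.biUnion σ) v := by
  rw [signExp, ← h.card_biUnion, pos, pos, add_right_inj, ← Finset.card_union_of_disjoint]
  · congr 1
    ext x
    simp only [Finset.mem_union, Finset.mem_filter, Finset.mem_biUnion, Finset.mem_Iio,
      Finset.mem_univ, true_and]
    constructor
    · rintro (⟨hx, hle⟩ | ⟨l', hl', hx⟩)
      · exact ⟨⟨l, hx⟩, hle⟩
      · exact ⟨⟨l', hx⟩, (h.ordered l' l hl' x hx v hv).le⟩
    · rintro ⟨⟨l', hx⟩, hle⟩
      rcases lt_trichotomy l' l with hl | rfl | hl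
      · exact Or.inr ⟨l', hl, hx⟩
      · exact Or.inl ⟨hx, hle⟩
      · exact absurd (h.ordered l l' hl v hv x hx) (not_lt.2 hle)
  · rw [Finset.disjoint_left]
    intro x hx hx'
    obtain ⟨l', hl', hx'⟩ := Finset.mem_biUnion.1 hx'
    exact (Finset.mem_Iio.1 hl').ne (h.index_unique hx' (Finset.mem_filter.1 hx).1)

theorem pos_union (h : Disjoint m α) (v : Fin n) : pos (m ∪ α) v = pos m v + pos α v := by
  rw [pos, pos, pos, Finset.filter_union,
    Finset.card_union_of_disjoint (Finset.disjoint_filter_filter h)]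

/-- Exactly l elements of m lie below v, and the sign convention contributes another l, so only the
position in α affects the sign. -/
theorem signExp_cellOf_of_mem_right (hm : m.card = d) (hα : IsLinear H m α) {l : Fin d}
    {v : Fin n} (hv : v ∈ α) (hvl : v ∈ cellOf d m α l) :
    signExp (cellOf d m α) l v = 2 * l + pos α v := by
  rw [(isTop_cellOf hm α).signExp_eq hvl, biUnion_cellOf hm hα.exists_lt, pos_union hα.disjoint]
  have hvm : v ∉ m := Finset.disjoint_right.1 hα.disjoint hv
  have : pos m v = l := by
    rw [← (Finset.mem_filter.1 hvl).2, pos]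
    congr 1
    refine Finset.filter_congr fun x hx => ⟨fun h => lt_of_le_of_ne h ?_, le_of_lt⟩
    rintro rfl
    exact hvm hx
  omega

/-- Now l + 1 elements of m are at most p, and j is the last element of α before p. The additional 1
gives the sign opposite to that of removing j. -/
theorem signExp_cellOf_of_mem_left (hm : m.card = d) (hα : IsLinear H m α) {l : Fin d}
    {p j : Fin n} (hp : p ∈ m) (hpl : p ∈ cellOf d m α l) (hj : j ∈ cellOf d m α l) (hjp : j ≠ p)
    (hmax : ∀ x ∈ cellOf d m α l, x ≠ p → x ≤ j) :
    signExp (cellOf d m α) l p = 2 * l + 1 + pos α j := by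
  have htop := isTop_cellOf hm α
  rw [htop.signExp_eq hpl, biUnion_cellOf hm hα.exists_lt, pos_union hα.disjoint]
  have h1 : pos m p = l + 1 := by
    rw [← (Finset.mem_filter.1 hpl).2, pos, ← Finset.card_insert_of_notMem (a := p) (by simp)]
    congr 1
    ext x
    simp only [Finset.mem_filter, Finset.mem_insert, le_iff_eq_or_lt]
    constructor
    · rintro ⟨hx, rfl | h⟩
      · exact Or.inl rfl
      · exact Or.inr ⟨hx, h⟩
    · rintro (rfl | h)
      · exact ⟨hp, Or.inl rfl⟩
      · exact ⟨h.1, Or.inr h.2⟩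
  have hjlt : j ≤ p := by
    obtain ⟨l', -, rfl⟩ := Finset.mem_image.1 ((Finset.image_orderEmbOfFin_univ m hm).symm ▸ hp)
    obtain rfl := htop.index_unique hpl (htop.mem l')
    exact htop.le l j hj
  have h2 : pos α p = pos α j := by
    rw [pos, pos]
    congr 1
    refine Finset.filter_congr fun x hx => ⟨fun h => ?_, fun h => h.trans hjlt⟩
    have hxp : x ≠ p := by
      rintro rfl
      exact Finset.disjoint_left.1 hα.disjoint hp hx
    have hxu : x ∈ Finset.univ.biUnion (cellOf d m α) := by
      rw [biUnion_cellOf hm hα.exists_lt]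
      exact Finset.mem_union_right _ hx
    obtain ⟨l', -, hx'⟩ := Finset.mem_biUnion.1 hxu
    rcases lt_trichotomy l' l with hl | rfl | hl
    · exact (htop.ordered l' l hl x hx' j hj).le
    · exact hmax x hx' hxp
    · exact absurd (htop.ordered l l' hl p hpl x hx') (not_lt.2 h)
  omega

end

end HomCone

namespace HomCone

/-! ### The differential on symbols -/

section

variable {n d : ℕ} {V : Finset (Fin n)} {H : Finset (Finset (Fin n))} {m α : Finset (Fin n)}

theorem freeComplex_d {R : Type*} [CommRing R] (B : ℕ → Type)
    (D : ∀ i, (B (i + 1) →₀ R) →ₗ[R] (B i →₀ R)) (hD : ∀ i, D i ∘ₗ D (i + 1) = 0) (i : ℕ) :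
    (freeComplex B D hD).d (i + 1) i = ModuleCat.ofHom (D i) :=
  ChainComplex.of_d (fun i => ModuleCat.of R (B i →₀ R)) (fun i => ModuleCat.ofHom (D i)) i

theorem exists_mem_cellOf (hm : m.card = d) (hα : IsLinear H m α) {x : Fin n} (hx : x ∈ m ∪ α) :
    ∃ l, x ∈ cellOf d m α l := by
  rw [← biUnion_cellOf hm hα.exists_lt] at hx
  obtain ⟨l, -, h⟩ := Finset.mem_biUnion.1 hx
  exact ⟨l, h⟩

theorem eq_of_mem_cellOf (hm : m.card = d) {l : Fin d} {p p' : Fin n} (hp : p ∈ m)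
    (hpl : p ∈ cellOf d m α l) (hp' : p' ∈ m) (hpl' : p' ∈ cellOf d m α l) : p = p' := by
  have htop := isTop_cellOf hm α
  have himg := Finset.image_orderEmbOfFin_univ m hm
  obtain ⟨l', -, rfl⟩ := Finset.mem_image.1 (himg.symm ▸ hp)
  obtain ⟨l'', -, rfl⟩ := Finset.mem_image.1 (himg.symm ▸ hp')
  obtain rfl := htop.index_unique hpl (htop.mem l')
  obtain rfl := htop.index_unique hpl' (htop.mem l'')
  rfl

theorem IsPart.mem_cellOf_of_mem {p a : Fin n} (h : IsPart H m p a) (hp : p ∈ m) (ha : a ∈ α)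
    {l : Fin d} : a ∈ cellOf d m α l ↔ p ∈ cellOf d m α l := by
  rw [h.mem_cellOf ha]
  exact or_iff_left fun h' => h'.1 (Finset.mem_union_left _ hp)

/-- This identifies a factor without its maximum with the intersection of α with one of the sets
A_ℓ. -/
theorem mem_cellOf_ne_iff (hm : m.card = d) (hα : IsLinear H m α) {l : Fin d} {p : Fin n}
    (hp : p ∈ m) (hpl : p ∈ cellOf d m α l) {x : Fin n} :
    (x ∈ cellOf d m α l ∧ x ≠ p) ↔ x ∈ α ∧ IsPart H m p x := by
  constructor
  · rintro ⟨hx, hne⟩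
    rcases Finset.mem_union.1 (Finset.mem_filter.1 hx).1 with hxm | hxα
    · exact absurd (eq_of_mem_cellOf hm hxm hx hp hpl) hne
    · obtain ⟨p', hp', hpart⟩ := hα x hxα
      obtain rfl := eq_of_mem_cellOf hm hp hpl hp' ((hpart.mem_cellOf_of_mem hp' hxα).1 hx)
      exact ⟨hxα, hpart⟩
  · rintro ⟨hx, hpart⟩
    exact ⟨(hpart.mem_cellOf_of_mem hp hx).2 hpl, hpart.2.1.ne⟩

/-- T(α) consists of the second largest elements of the factors that have at least two elements. -/
theorem IsExchange.mem_topSet (hH : IsExchange d V H) (k : Type*) [Field k] (hm : m ∈ H)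
    (hα : IsLinear H m α) {j : Fin n} :
    j ∈ topSet k H m α ↔ ∃ q : Fin d × Fin n, q.2 ∈ m ∧ q.2 ∈ cellOf d m α q.1 ∧
      j ∈ cellOf d m α q.1 ∧ j ≠ q.2 ∧ ∀ x ∈ cellOf d m α q.1, x ≠ q.2 → x ≤ j := by
  have hc := hH.card m hm
  simp only [topSet, Finset.mem_filter]
  constructor
  · rintro ⟨hj, p, hp, ⟨-, hpart⟩, hub⟩
    rw [hH.isInPart_iff k hm hp] at hpart
    obtain ⟨l, hl⟩ := exists_mem_cellOf hc hα (Finset.mem_union_right _ hj)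
    have hpl := (hpart.mem_cellOf_of_mem hp hj).1 hl
    refine ⟨(l, p), hp, hpl, hl, hpart.2.1.ne, fun x hx hne => hub ?_⟩
    have := (mem_cellOf_ne_iff hc hα hp hpl).1 ⟨hx, hne⟩
    exact ⟨this.1, (hH.isInPart_iff k hm hp).2 this.2⟩
  · rintro ⟨⟨l, p⟩, hp, hpl, hl, hne, hmax⟩
    have := (mem_cellOf_ne_iff hc hα hp hpl).1 ⟨hl, hne⟩
    refine ⟨this.1, p, hp, ⟨this.1, (hH.isInPart_iff k hm hp).2 this.2⟩, ?_⟩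
    rintro t ⟨ht, hpt⟩
    rw [hH.isInPart_iff k hm hp] at hpt
    obtain ⟨h1, h2⟩ := (mem_cellOf_ne_iff hc hα hp hpl).2 ⟨ht, hpt⟩
    exact hmax t h1 h2

theorem IsPart.decomp_eq {p j : Fin n} (h : IsPart H m p j) (hp : p ∈ m) :
    decomp j m = insert j (m.erase p) := by
  have hleast : IsLeast {q | q ∈ m ∧ j ≤ q} p := by
    refine ⟨⟨hp, h.2.1.le⟩, fun q hq => ?_⟩
    by_contra hlt
    exact absurd (h.1 q hq.1 (not_le.1 hlt)) (not_lt.2 hq.2)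
  rw [decomp]
  congr 1
  ext x
  simp only [Finset.mem_filter, Finset.mem_erase]
  rw [and_comm]
  refine and_congr_left fun _ => not_congr ⟨fun hx => hx.unique hleast, ?_⟩
  rintro rfl
  exact hleast

/-- The facet that omits p is a cell with known maxima and known union, so `IsTop.exists_symbol`
yields both claims without further exchanges. -/
theorem IsExchange.isLinear_facet (hH : IsExchange d V H) (hm : m ∈ H) (hα : IsLinear H m α)
    {l : Fin d} {p j : Fin n} (hp : p ∈ m) (hpl : p ∈ cellOf d m α l) (hj : j ∈ cellOf d m α l)
    (hjp : j ≠ p) (hmax : ∀ x ∈ cellOf d m α l, x ≠ p → x ≤ j) :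
    insert j (m.erase p) ∈ H ∧ IsLinear H (insert j (m.erase p)) (α.erase j) := by
  have hc := hH.card m hm
  have htop := isTop_cellOf hc α
  have himg := Finset.image_orderEmbOfFin_univ m hc
  have hσ := hH.isCell_cellOf hm hα
  have hdel := isCell_del hσ (q := (l, p)) (mem_removable.2 ⟨hpl,
    Finset.one_lt_card.2 ⟨j, hj, p, hpl, hjp⟩⟩)
  obtain ⟨l', -, rfl⟩ := Finset.mem_image.1 (himg.symm ▸ hp)
  obtain rfl := htop.index_unique hpl (htop.mem l')
  obtain ⟨m', hm', α', h1, h2, h3, -⟩ := (htop.del_top hj hjp hmax).exists_symbol hdel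
  rw [image_update htop.strictMono.injective, himg] at h1
  subst h1
  refine ⟨hm', h3.mono ?_⟩
  rw [h2, htop.biUnion_del hpl, biUnion_cellOf hc hα.exists_lt]
  intro x hx
  obtain ⟨hxj, hxα⟩ := Finset.mem_erase.1 hx
  have hxm : x ∉ m := Finset.disjoint_right.1 hα.disjoint hxα
  have hxp : x ≠ m.orderEmbOfFin hc l := by
    rintro rfl
    exact hxm hp
  simp [hxj, hxα, hxm, hxp]

/-- Facets that omit an element of α become the first sum. Those that omit an element of m stay in
cellular form, since they define the comparison map of the cone. -/
theorem IsExchange.cellD_cellOf (hH : IsExchange d V H) (k : Type*) [Field k] (hm : m ∈ H)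
    (hα : IsLinear H m α) {i : ℕ} (hi : α.card = i + 1) :
    cellD k d H (i + 1) (cellVec k d H (i + 1) (cellOf d m α)) =
      ∑ j ∈ α, ((-1) ^ pos α j * X j : MvPolynomial (Fin n) k) •
        cellVec k d H i (cellOf d m (α.erase j)) +
      ∑ q ∈ (removable (cellOf d m α)).filter (fun q => q.2 ∈ m),
        ((-1) ^ signExp (cellOf d m α) q.1 q.2 * X q.2 : MvPolynomial (Fin n) k) •
          cellVec k d H i (del (cellOf d m α) q.1 q.2) := by
  have hc := hH.card m hm
  have htop := isTop_cellOf hc α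
  rw [cellD_cellVec k d H i _ ⟨hH.isCell_cellOf hm hα, (hH.cellDim_cellOf hm hα).trans hi⟩,
    ← Finset.sum_filter_add_sum_filter_not _ (fun q : Fin d × Fin n => q.2 ∈ m)]
  refine (add_comm _ _).trans (congrArg (· + _) ?_)
  have hmem : ∀ q ∈ (removable (cellOf d m α)).filter (fun q => q.2 ∉ m),
      q.2 ∈ α ∧ q.2 ∈ cellOf d m α q.1 := by
    intro q hq
    rw [Finset.mem_filter, mem_removable] at hq
    exact ⟨(Finset.mem_union.1 (Finset.mem_filter.1 hq.1.1).1).resolve_left hq.2, hq.1.1⟩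
  refine Finset.sum_nbij Prod.snd (fun q hq => (hmem q hq).1) ?_ ?_ ?_
  · rintro ⟨l, v⟩ hq ⟨l', v'⟩ hq' (rfl : v = v')
    exact Prod.ext (htop.index_unique (hmem _ hq).2 (hmem _ hq').2) rfl
  · intro v hv
    obtain ⟨l, hl⟩ := exists_mem_cellOf hc hα (Finset.mem_union_right _ hv)
    have hvm : v ∉ m := Finset.disjoint_right.1 hα.disjoint hv
    refine ⟨(l, v), ?_, rfl⟩
    simp only [Finset.coe_filter, Set.mem_ofPred_eq, mem_removable]
    -- The factor of v also contains its maximum, which lies in m and therefore differs from v.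
    refine ⟨⟨hl, Finset.one_lt_card.2 ⟨v, hl, _, htop.mem l, ?_⟩⟩, hvm⟩
    intro e
    exact hvm (e ▸ Finset.orderEmbOfFin_mem _ _ _)
  · rintro ⟨l, v⟩ hq
    obtain ⟨h1, h2⟩ := hmem _ hq
    rw [signExp_cellOf_of_mem_right hc hα h1 h2, del_cellOf_of_mem_right hc hα h1 h2, pow_add,
      pow_mul, neg_one_sq, one_pow, one_mul]

theorem monomial_exchange (k : Type*) [Field k] {p j : Fin n} (hp : p ∈ m) (hj : j ∉ m) :
    (monomial (Finsupp.single j 1 + expo m - expo (insert j (m.erase p))) 1 :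
      MvPolynomial (Fin n) k) = X p := by
  have h1 : expo m = Finsupp.single p 1 + expo (m.erase p) := (Finset.add_sum_erase _ _ hp).symm
  have h2 : expo (insert j (m.erase p)) = Finsupp.single j 1 + expo (m.erase p) :=
    Finset.sum_insert (fun h => hj (Finset.mem_of_mem_erase h))
  rw [X, h1, h2, add_left_comm, add_tsub_cancel_right]

/-- A factor with at least two elements has one removable element in m, its maximum, and one element
in T(α), the next largest. This matches the index sets. -/
theorem IsExchange.sum_removable_eq_sum_topSet (hH : IsExchange d V H) (k : Type*) [Field k]
    (hm : m ∈ H) (hα : IsLinear H m α) (i : ℕ) :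
    ∑ q ∈ (removable (cellOf d m α)).filter (fun q => q.2 ∈ m),
        ((-1) ^ signExp (cellOf d m α) q.1 q.2 * X q.2 : MvPolynomial (Fin n) k) •
          cellVec k d H i (del (cellOf d m α) q.1 q.2) =
      ∑ j ∈ topSet k H m α, ((-1) ^ (pos α j - 1) *
          monomial (Finsupp.single j 1 + expo m - expo (decomp j m)) 1 :
            MvPolynomial (Fin n) k) • cellVec k d H i (cellOf d (decomp j m) (α.erase j)) := by
  have hc := hH.card m hm
  have htop := isTop_cellOf hc α
  have key := fun j => (hH.mem_topSet k hm hα (j := j)).1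
  choose f hf using key
  symm
  refine Finset.sum_bij f ?_ ?_ ?_ ?_
  · intro j hj
    obtain ⟨h1, h2, h3, h4, h5⟩ := hf j hj
    exact Finset.mem_filter.2 ⟨mem_removable.2 ⟨h2, Finset.one_lt_card.2 ⟨j, h3, _, h2, h4⟩⟩, h1⟩
  · intro j hj j' hj' he
    obtain ⟨h1, h2, h3, h4, h5⟩ := hf j hj
    obtain ⟨-, -, h3', h4', h5'⟩ := hf j' hj'
    rw [← he] at h3' h4' h5'
    exact le_antisymm (h5' j h3 h4) (h5 j' h3' h4')
  · rintro ⟨l, p⟩ hq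
    rw [Finset.mem_filter, mem_removable] at hq
    obtain ⟨⟨hpl, h2⟩, hp⟩ := hq
    simp only at hpl h2 hp
    have hne : ((cellOf d m α l).erase p).Nonempty := by
      rw [← Finset.card_pos, Finset.card_erase_of_mem hpl]
      omega
    have hj := Finset.max'_mem _ hne
    rw [Finset.mem_erase] at hj
    have hjt : ((cellOf d m α l).erase p).max' hne ∈ topSet k H m α :=
      (hH.mem_topSet k hm hα).2 ⟨(l, p), hp, hpl, hj.2, hj.1,
        fun x hx hxp => Finset.le_max' _ _ (Finset.mem_erase.2 ⟨hxp, hx⟩)⟩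
    refine ⟨_, hjt, ?_⟩
    obtain ⟨h1, h2, h3, h4, h5⟩ := hf _ hjt
    have hl := htop.index_unique h3 hj.2
    refine Prod.ext hl ?_
    rw [hl] at h2
    exact eq_of_mem_cellOf hc h1 h2 hp hpl
  · intro j hj
    obtain ⟨h1, h2, h3, h4, h5⟩ := hf j hj
    obtain ⟨hjα, hpart⟩ := (mem_cellOf_ne_iff hc hα h1 h2).1 ⟨h3, h4⟩
    rw [signExp_cellOf_of_mem_left hc hα h1 h2 h3 h4 h5,
      del_cellOf_of_mem_left hc hα h1 h2 h3 h4 h5, hpart.decomp_eq h1,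
      monomial_exchange k h1 hpart.notMem]
    -- Positions start with 1, so the subtraction in the exponent is not truncated.
    have hpos : 1 ≤ pos α j := Finset.card_pos.2 ⟨j, by simp [hjα]⟩
    obtain ⟨t, ht⟩ := Nat.exists_eq_add_of_le' hpos
    rw [ht, Nat.add_sub_cancel, show 2 * (f j hj).1.1 + 1 + (t + 1) = 2 * ((f j hj).1.1 + 1) + t by
      ring, pow_add _ (2 * _), pow_mul, neg_one_sq, one_pow, one_mul]

theorem IsExchange.differential (hH : IsExchange d V H) (k : Type*) [Field k] (i : ℕ) (hm : m ∈ H)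
    (hα : α ⊆ linSet k H m) (hi : α.card = i + 1) :
    (∀ j ∈ topSet k H m α, decomp j m ∈ H ∧ α.erase j ⊆ linSet k H (decomp j m)) ∧
      ((homComplex k d H).d (i + 2) (i + 1)).hom (symb k d H (i + 1) m α) =
        ∑ j ∈ α, ((-1) ^ pos α j * X j : MvPolynomial (Fin n) k) •
            symb k d H i m (α.erase j) +
        ∑ j ∈ topSet k H m α, ((-1) ^ (pos α j - 1) *
            monomial (Finsupp.single j 1 + expo m - expo (decomp j m)) 1 :
              MvPolynomial (Fin n) k) •
            symb k d H i (decomp j m) (α.erase j) := by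
  have hα := (hH.isLinear_iff k hm).2 hα
  constructor
  · intro j hj
    obtain ⟨q, h1, h2, h3, h4, h5⟩ := (hH.mem_topSet k hm hα).1 hj
    obtain ⟨hjα, hpart⟩ := (mem_cellOf_ne_iff (hH.card m hm) hα h1 h2).1 ⟨h3, h4⟩
    obtain ⟨h6, h7⟩ := hH.isLinear_facet hm hα h1 h2 h3 h4 h5
    rw [hpart.decomp_eq h1]
    exact ⟨h6, (hH.isLinear_iff k h6).1 h7⟩
  · rw [freeComplex_d]
    have := hH.cellD_cellOf k hm hα hi
    rw [hH.sum_removable_eq_sum_topSet k hm hα] at this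
    exact this

/-! ### Labels of cells and the differential on vertices -/

theorem isLinear_empty : IsLinear H m ∅ := fun _ h => absurd h (Finset.notMem_empty _)

theorem cellLabel_eq_expo {σ : Fin d → Finset (Fin n)} {u : Fin d → Fin n} (h : IsTop σ u) :
    cellLabel σ = expo (Finset.univ.biUnion σ) := by
  rw [cellLabel, expo, Finset.sum_biUnion]
  · rfl
  · intro l _ l' _ hne
    rw [Function.onFun, Finset.disjoint_left]
    intro x hx hx'
    exact hne (h.index_unique hx hx')

theorem IsExchange.cellLabel_cellOf (hH : IsExchange d V H) (hm : m ∈ H) (hα : IsLinear H m α) :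
    cellLabel (cellOf d m α) = expo (m ∪ α) := by
  rw [cellLabel_eq_expo (isTop_cellOf (hH.card m hm) α),
    biUnion_cellOf (hH.card m hm) hα.exists_lt]

theorem IsExchange.cellD_zero_cellOf (hH : IsExchange d V H) (k : Type*) [Field k] (hm : m ∈ H) :
    cellD k d H 0 (cellVec k d H 0 (cellOf d m ∅)) = Finsupp.single .empty (mon k m) := by
  rw [cellD_zero_cellVec k d H _ ⟨hH.isCell_cellOf hm isLinear_empty,
    hH.cellDim_cellOf hm isLinear_empty⟩, hH.cellLabel_cellOf hm isLinear_empty,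
    Finset.union_empty, mon]

theorem IsExchange.differential_empty (hH : IsExchange d V H) (k : Type*) [Field k] (hm : m ∈ H) :
    ((homComplex k d H).d 1 0).hom (symb k d H 0 m ∅) =
      mon k m • cellBasis k d H 0 .empty := by
  rw [freeComplex_d]
  refine (hH.cellD_zero_cellOf k hm).trans ?_
  simp [cellBasis]

end

end HomCone

namespace HomCone

/-! ### Exactness of cones and resolutions with a given basis -/

section

variable {R : Type*} [CommRing R]

/-- Exactness in the middle of a cone whose terms are `E_i = ι(F_i) + s(K_{i-1})`, with the
differential `D (ι y + s z) = ι (d y + ψ z) - s (∂ z)`. -/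
theorem exact_of_cone {F₂ F₁ F₀ K₁ K₀ Z E₂ E₁ E₀ : Type*}
    [AddCommGroup F₂] [AddCommGroup F₁] [AddCommGroup F₀] [AddCommGroup K₁] [AddCommGroup K₀]
    [AddCommGroup Z] [AddCommGroup E₂] [AddCommGroup E₁] [AddCommGroup E₀]
    [Module R F₂] [Module R F₁] [Module R F₀] [Module R K₁] [Module R K₀] [Module R Z]
    [Module R E₂] [Module R E₁] [Module R E₀]
    {d₂ : F₂ →ₗ[R] F₁} {d₁ : F₁ →ₗ[R] F₀} {b₁ : K₁ →ₗ[R] K₀} {b₀ : K₀ →ₗ[R] Z}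
    {D₂ : E₂ →ₗ[R] E₁} {D₁ : E₁ →ₗ[R] E₀} {ι₂ : F₂ →ₗ[R] E₂} {ι₁ : F₁ →ₗ[R] E₁}
    {s₁ : K₁ →ₗ[R] E₂} {s₀ : K₀ →ₗ[R] E₁} {ψ₁ : K₁ →ₗ[R] F₁} {ψ₀ : K₀ →ₗ[R] F₀}
    (hF : Function.Exact d₂ d₁) (hK : Function.Exact b₁ b₀)
    (hD : ∀ x, D₁ (D₂ x) = 0)
    (hdec : ∀ x, ∃ y z, x = ι₁ y + s₀ z)
    (hker : ∀ y z, D₁ (ι₁ y + s₀ z) = 0 → d₁ y + ψ₀ z = 0 ∧ b₀ z = 0)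
    (hι : ∀ y, D₂ (ι₂ y) = ι₁ (d₂ y)) (hs : ∀ z, D₂ (s₁ z) = ι₁ (ψ₁ z) - s₀ (b₁ z))
    (hψ : ∀ z, ψ₀ (b₁ z) = d₁ (ψ₁ z)) : Function.Exact D₂ D₁ := by
  intro x
  constructor
  · intro hx
    obtain ⟨y, z, rfl⟩ := hdec x
    -- The kernel condition is assumed instead of a formula for `D₁`, so that in the lowest degree
    -- `b₀` may be an augmentation.
    obtain ⟨h1, h2⟩ := hker y z hx
    obtain ⟨w, rfl⟩ := (hK z).1 h2
    -- With z = b₁ w, the element y + ψ₁ w is a cycle, hence the boundary of some t; subtracting the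
    -- shifted w from t gives the preimage.
    rw [hψ, ← map_add] at h1
    obtain ⟨t, ht⟩ := (hF _).1 h1
    refine ⟨ι₂ t - s₁ w, ?_⟩
    rw [map_sub, hι, hs, ht, map_add]
    abel
  · rintro ⟨w, rfl⟩
    exact hD w

/-- With `eq_zero_of_mapDomain_add` this turns a partition of a basis into a direct sum
decomposition. -/
theorem exists_mapDomain_add {P Q T : Type*} {f : P → T} {g : Q → T}
    (h : Function.Surjective (Sum.elim f g)) (x : T →₀ R) :
    ∃ y z, x = Finsupp.lmapDomain R R f y + Finsupp.lmapDomain R R g z := by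
  induction x using Finsupp.induction_linear with
  | zero => exact ⟨0, 0, by simp⟩
  | add x x' hx hx' =>
    obtain ⟨y, z, rfl⟩ := hx
    obtain ⟨y', z', rfl⟩ := hx'
    exact ⟨y + y', z + z', by rw [map_add, map_add]; abel⟩
  | single t a =>
    obtain ⟨p | q, rfl⟩ := h t
    · exact ⟨Finsupp.single p a, 0, by simp⟩
    · exact ⟨0, Finsupp.single q a, by simp⟩

theorem mapDomain_apply_of_ne {P T : Type*} {f : P → T} {t : T} (h : ∀ p, f p ≠ t) (y : P →₀ R) :
    Finsupp.lmapDomain R R f y t = 0 :=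
  Finsupp.mapDomain_of_notMem_range _ _ fun ⟨p, hp⟩ => h p hp

theorem eq_zero_of_mapDomain_add {P Q T : Type*} {f : P → T} {g : Q → T}
    (h : Function.Injective (Sum.elim f g)) {y : P →₀ R} {z : Q →₀ R}
    (hyz : Finsupp.lmapDomain R R f y + Finsupp.lmapDomain R R g z = 0) : y = 0 ∧ z = 0 := by
  have hf : Function.Injective f := fun p p' hp => Sum.inl_injective (@h (.inl p) (.inl p') hp)
  have hg : Function.Injective g := fun p p' hp => Sum.inr_injective (@h (.inr p) (.inr p') hp)
  have hfg : ∀ p q, f p ≠ g q := fun p q hpq => by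
    have := @h (.inl p) (.inr q) hpq
    cases this
  constructor
  · ext p
    have := DFunLike.congr_fun hyz (f p)
    rw [Finsupp.add_apply, mapDomain_apply_of_ne (fun q => (hfg p q).symm), add_zero] at this
    exact (Finsupp.mapDomain_apply hf y p).symm.trans this
  · ext q
    have := DFunLike.congr_fun hyz (g q)
    rw [Finsupp.add_apply, mapDomain_apply_of_ne (fun p => hfg p q), zero_add] at this
    exact (Finsupp.mapDomain_apply hg z q).symm.trans this

/-- A presentation of `R / I`, where `I` is generated by the family `f`. -/
theorem exact_presentation {B₁ B₀ : Type*} [Unique B₀] (f : B₁ → R) {I : Ideal R}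
    (hI : I = Ideal.span (Set.range f)) {D : (B₁ →₀ R) →ₗ[R] (B₀ →₀ R)}
    (hD : ∀ s, D (Finsupp.single s 1) = Finsupp.single default (f s)) :
    Function.Exact D (Finsupp.linearCombination R (fun _ : B₀ => (1 : R ⧸ I))) := by
  have hε : ∀ x : B₀ →₀ R, Finsupp.linearCombination R (fun _ : B₀ => (1 : R ⧸ I)) x =
      Ideal.Quotient.mk I (x default) := by
    intro x
    rw [Finsupp.unique_single x, Finsupp.linearCombination_single, Finsupp.single_eq_same,
      Algebra.smul_def, mul_one]
    rfl
  intro x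
  rw [hε, Ideal.Quotient.eq_zero_iff_mem, hI]
  constructor
  · intro hx
    -- The scalars whose multiple of the basis vector is a boundary form an ideal, so only the
    -- generators need checking.
    have hle : Ideal.span (Set.range f) ≤
        (LinearMap.range D).comap (Finsupp.lsingle default) := by
      refine Ideal.span_le.2 ?_
      rintro _ ⟨s, rfl⟩
      exact ⟨Finsupp.single s 1, hD s⟩
    have := hle hx
    rw [Submodule.mem_comap, Finsupp.lsingle_apply, ← Finsupp.unique_single x] at this
    exact this
  · rintro ⟨y, rfl⟩
    induction y using Finsupp.induction_linear with
    | zero => simp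
    | add y y' hy hy' =>
      rw [map_add, Finsupp.add_apply]
      exact add_mem hy hy'
    | single s a =>
      rw [← mul_one a, ← smul_eq_mul, ← Finsupp.smul_single, map_smul, hD, Finsupp.smul_apply,
        Finsupp.single_eq_same]
      exact Ideal.mul_mem_left _ _ (Ideal.subset_span ⟨s, rfl⟩)

end

/-! ### Minimal graded resolutions over the polynomial ring -/

section

variable {k : Type*} [Field k] {n : ℕ}

/-- The ideal generated by the variables. -/
noncomputable abbrev varIdeal (k : Type*) [Field k] (n : ℕ) : Ideal (MvPolynomial (Fin n) k) :=
  Ideal.span (Set.range (X : Fin n → MvPolynomial (Fin n) k))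

/-- The linear map between free modules over the polynomial ring given by a map of the bases. -/
noncomputable abbrev relabel (k : Type*) [Field k] {n : ℕ} {P T : Type*} (f : P → T) :
    (P →₀ MvPolynomial (Fin n) k) →ₗ[MvPolynomial (Fin n) k] (T →₀ MvPolynomial (Fin n) k) :=
  Finsupp.lmapDomain (MvPolynomial (Fin n) k) (MvPolynomial (Fin n) k) f

/-- Homogeneity and minimality are reduced to basis elements, where the explicit differentials of
both complexes apply. -/
theorem isMinimalGradedFreeResolution_freeComplex {B : ℕ → Type}
    {D : ∀ i, (B (i + 1) →₀ MvPolynomial (Fin n) k) →ₗ[MvPolynomial (Fin n) k]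
      (B i →₀ MvPolynomial (Fin n) k)} (hD : ∀ i, D i ∘ₗ D (i + 1) = 0)
    {I : Ideal (MvPolynomial (Fin n) k)} {deg : ∀ i, B i → (Fin n →₀ ℕ)}
    [hfin : ∀ i, Finite (B i)] (hdeg : ∀ s, deg 0 s = 0) [hB : Nonempty (B 0)]
    (hhom : ∀ i s t, ∀ u ∈ (D i (Finsupp.single s 1) t).support, u + deg i t = deg (i + 1) s)
    (hmin : ∀ i s, D i (Finsupp.single s 1) ∈
      varIdeal k n • (⊤ : Submodule (MvPolynomial (Fin n) k) (B i →₀ MvPolynomial (Fin n) k)))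
    (hex : Function.Exact (D 0) (Finsupp.linearCombination (MvPolynomial (Fin n) k)
      (fun _ : B 0 => (1 : MvPolynomial (Fin n) k ⧸ I))))
    (hexs : ∀ i, Function.Exact (D (i + 1)) (D i)) :
    IsMinimalGradedFreeResolution I (freeComplex B D hD)
      (fun _ => (Finsupp.basisSingleOne : Module.Basis _ (MvPolynomial (Fin n) k) _)) deg
      (Finsupp.linearCombination (MvPolynomial (Fin n) k)
        (fun _ : B 0 => (1 : MvPolynomial (Fin n) k ⧸ I))) where
  finite := hfin
  homogeneous i s t u hu := by
    rw [freeComplex_d] at hu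
    exact hhom i s t u (by simpa using hu)
  aug_homogeneous s := by
    refine ⟨1, ?_⟩
    rw [hdeg]
    refine (congrArg _ (congrFun Finsupp.coe_basisSingleOne s)).trans ?_
    rw [Finsupp.linearCombination_single, one_smul]
    rfl
  aug_surjective y := by
    obtain ⟨s⟩ := hB
    obtain ⟨r, rfl⟩ := Ideal.Quotient.mk_surjective y
    refine ⟨(Finsupp.single s r : B 0 →₀ MvPolynomial (Fin n) k), ?_⟩
    rw [Finsupp.linearCombination_single]
    exact congrArg (Ideal.Quotient.mk I) (mul_one r)
  exact_zero := by
    rw [freeComplex_d]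
    exact hex
  exact_succ i := by
    rw [freeComplex_d, freeComplex_d]
    exact hexs i
  minimal i x := by
    rw [freeComplex_d]
    have h : ∀ x : B (i + 1) →₀ MvPolynomial (Fin n) k, D i x ∈ varIdeal k n •
        (⊤ : Submodule (MvPolynomial (Fin n) k) (B i →₀ MvPolynomial (Fin n) k)) := by
      intro x
      induction x using Finsupp.induction_linear with
      | zero => simp
      | add x y hx hy =>
        rw [map_add]
        exact add_mem hx hy
      | single s a =>
        rw [← mul_one a, ← smul_eq_mul, ← Finsupp.smul_single, map_smul]
        exact Submodule.smul_mem _ _ (hmin i s)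
    exact h x

theorem X_mem_varIdeal (v : Fin n) : (X v : MvPolynomial (Fin n) k) ∈ varIdeal k n :=
  Ideal.subset_span ⟨v, rfl⟩

/-- Cancellation can only shrink the support, so every monomial comes from a single term ±x_v. -/
theorem exists_of_mem_support_sum {ι B : Type*} {s : Finset ι} {e : ι → ℕ} {v : ι → Fin n}
    {w : ι → B →₀ MvPolynomial (Fin n) k} {t : B} (hw : ∀ q ∈ s, w q t = 0 ∨ w q t = 1)
    {u : Fin n →₀ ℕ}
    (hu : u ∈ ((∑ q ∈ s, ((-1) ^ e q * X (v q) : MvPolynomial (Fin n) k) • w q) t).support) :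
    ∃ q ∈ s, u = Finsupp.single (v q) 1 ∧ w q t = 1 := by
  classical
  rw [Finsupp.finsetSum_apply] at hu
  obtain ⟨q, hq, hu⟩ := Finset.mem_biUnion.1 (support_sum hu)
  refine ⟨q, hq, ?_⟩
  rw [Finsupp.smul_apply] at hu
  rcases hw q hq with h | h
  · simp [h] at hu
  · refine ⟨?_, h⟩
    rw [h, smul_eq_mul, mul_one] at hu
    rcases neg_one_pow_eq_or (MvPolynomial (Fin n) k) (e q) with h' | h'
    · rw [h', one_mul, support_X] at hu
      simpa using hu
    · rw [h', neg_one_mul, support_neg, support_X] at hu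
      simpa using hu

theorem sum_mem_varIdeal_smul {ι M : Type*} [AddCommGroup M] [Module (MvPolynomial (Fin n) k) M]
    (s : Finset ι) (e : ι → ℕ) (v : ι → Fin n) (w : ι → M) :
    ∑ q ∈ s, ((-1) ^ e q * X (v q) : MvPolynomial (Fin n) k) • w q ∈
      varIdeal k n • (⊤ : Submodule (MvPolynomial (Fin n) k) M) :=
  sum_mem fun _ _ => Submodule.smul_mem_smul (Ideal.mul_mem_left _ _ (X_mem_varIdeal _)) trivial

/-! ### Exactness of the Koszul complex -/

/-- The inclusion of the basis of the Koszul complex on a smaller set. -/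
def koszulIncl {S S' : Finset (Fin n)} (h : S ⊆ S') (i : ℕ) (α : KoszulIndex S i) :
    KoszulIndex S' i :=
  ⟨α.1, α.2.1.trans h, α.2.2⟩

/-- Adding a new element to the index sets of a Koszul complex. -/
def koszulInsert {S : Finset (Fin n)} {v : Fin n} (h : v ∉ S) (i : ℕ) (α : KoszulIndex S i) :
    KoszulIndex (insert v S) (i + 1) :=
  ⟨insert v α.1, Finset.insert_subset_insert v α.2.1, by
    rw [Finset.card_insert_of_notMem fun hv => h (α.2.1 hv), α.2.2]⟩

theorem single_eq_koszulVec {S : Finset (Fin n)} {i : ℕ} (α : KoszulIndex S i) :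
    (Finsupp.single α 1 : KoszulIndex S i →₀ MvPolynomial (Fin n) k) = koszulVec k S i α.1 := by
  rw [koszulVec, dif_pos α.2]

theorem koszulVec_apply (S : Finset (Fin n)) (i : ℕ) (α : Finset (Fin n))
    (β : KoszulIndex S i) : koszulVec k S i α β = if α = β.1 then 1 else 0 := by
  classical
  rw [koszulVec]
  split_ifs with h1 h2 h2
  · rw [show (⟨α, h1⟩ : KoszulIndex S i) = β from Subtype.ext h2, Finsupp.single_eq_same]
  · rw [Finsupp.single_eq_of_ne]
    rintro rfl
    exact h2 rfl
  · subst h2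
    exact absurd β.2 h1
  · rfl

theorem relabel_incl_koszulVec {S S' : Finset (Fin n)} (h : S ⊆ S') (i : ℕ)
    {α : Finset (Fin n)} (hα : α ⊆ S) :
    relabel k (koszulIncl h i)
      (koszulVec k S i α) = koszulVec k S' i α := by
  by_cases hc : α.card = i
  · rw [koszulVec, koszulVec, dif_pos ⟨hα, hc⟩, dif_pos ⟨hα.trans h, hc⟩]
    simp [koszulIncl]
  · rw [koszulVec, koszulVec, dif_neg (fun h => hc h.2), dif_neg (fun h => hc h.2), map_zero]

theorem relabel_insert_koszulVec {S : Finset (Fin n)} {v : Fin n} (h : v ∉ S) (i : ℕ)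
    {α : Finset (Fin n)} (hα : α ⊆ S) :
    relabel k (koszulInsert h i)
      (koszulVec k S i α) = koszulVec k (insert v S) (i + 1) (insert v α) := by
  have hcard : (insert v α).card = α.card + 1 := Finset.card_insert_of_notMem fun hv => h (hα hv)
  by_cases hc : α.card = i
  · rw [koszulVec, koszulVec, dif_pos ⟨hα, hc⟩,
      dif_pos ⟨Finset.insert_subset_insert v hα, by rw [hcard, hc]⟩]
    simp [koszulInsert]
  · rw [koszulVec, koszulVec, dif_neg (fun h => hc h.2), dif_neg (fun h => hc (by omega)),
      map_zero]

theorem koszulD_incl {S S' : Finset (Fin n)} (h : S ⊆ S') (i : ℕ)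
    (y : KoszulIndex S (i + 1) →₀ MvPolynomial (Fin n) k) :
    koszulD k S' i (relabel k (koszulIncl h (i + 1)) y) =
      relabel k (koszulIncl h i) (koszulD k S i y) := by
  suffices koszulD k S' i ∘ₗ relabel k (koszulIncl h (i + 1)) =
      relabel k (koszulIncl h i) ∘ₗ koszulD k S i from LinearMap.congr_fun this y
  refine Finsupp.lhom_ext' fun α => LinearMap.ext_ring ?_
  simp only [LinearMap.comp_apply, Finsupp.lsingle_apply]
  rw [single_eq_koszulVec, relabel_incl_koszulVec h _ α.2.1, koszulD_koszulVec k S _ _ α.2,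
    koszulD_koszulVec k S' _ _ ⟨α.2.1.trans h, α.2.2⟩, map_sum]
  refine Finset.sum_congr rfl fun j _ => ?_
  rw [map_smul, relabel_incl_koszulVec h _ ((Finset.erase_subset _ _).trans α.2.1)]

theorem pos_insert_self {α : Finset (Fin n)} {v : Fin n} (h : ∀ x ∈ α, v < x) :
    pos (insert v α) v = 1 := by
  rw [pos, Finset.filter_insert, if_pos le_rfl, Finset.filter_false_of_mem]
  · simp
  · intro x hx
    exact not_le.2 (h x hx)

/-- As v precedes S, it has position 1 and raises every other position by one; hence the minus sign.
-/
theorem koszulD_insert_koszulVec {S : Finset (Fin n)} {v : Fin n} (hv : ∀ x ∈ S, v < x)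
    (i : ℕ) {β : Finset (Fin n)} (hβ : β ⊆ S ∧ β.card = i) :
    koszulD k (insert v S) i (koszulVec k (insert v S) (i + 1) (insert v β)) =
      (X v : MvPolynomial (Fin n) k) • koszulVec k (insert v S) i β -
        ∑ j ∈ β, ((-1) ^ (pos β j + 1) * X j : MvPolynomial (Fin n) k) •
          koszulVec k (insert v S) i (insert v (β.erase j)) := by
  have hvβ : v ∉ β := fun h => lt_irrefl v (hv v (hβ.1 h))
  rw [koszulD_koszulVec k _ _ _ ⟨Finset.insert_subset_insert v hβ.1, by
    rw [Finset.card_insert_of_notMem hvβ, hβ.2]⟩, Finset.sum_insert hvβ,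
    pos_insert_self fun x hx => hv x (hβ.1 hx), Finset.erase_insert hvβ, sub_eq_add_neg,
    ← Finset.sum_neg_distrib]
  congr 1
  · norm_num
  · refine Finset.sum_congr rfl fun j hj => ?_
    have hvj : v < j := hv j (hβ.1 hj)
    have h := pos_erase_of_lt (Finset.mem_insert_self v β) hvj
    rw [Finset.erase_insert hvβ] at h
    rw [← h, Finset.erase_insert_of_ne hvj.ne, ← neg_smul]
    congr 1
    ring

/-- Adding v makes the Koszul complex the cone of multiplication by x_v, in the form used by
`exact_of_cone`. -/
theorem koszulD_insert_succ {S : Finset (Fin n)} {v : Fin n} (hv : ∀ x ∈ S, v < x) (hvS : v ∉ S)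
    (i : ℕ) (z : KoszulIndex S (i + 1) →₀ MvPolynomial (Fin n) k) :
    koszulD k (insert v S) (i + 1) (relabel k (koszulInsert hvS (i + 1)) z) =
      relabel k (koszulIncl (Finset.subset_insert v S) (i + 1))
        ((X v : MvPolynomial (Fin n) k) • z) -
      relabel k (koszulInsert hvS i) (koszulD k S i z) := by
  suffices koszulD k (insert v S) (i + 1) ∘ₗ relabel k (koszulInsert hvS (i + 1)) =
      (X v : MvPolynomial (Fin n) k) •
        relabel k (koszulIncl (Finset.subset_insert v S) (i + 1)) -
      relabel k (koszulInsert hvS i) ∘ₗ koszulD k S i by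
    simpa using LinearMap.congr_fun this z
  refine Finsupp.lhom_ext' fun β => LinearMap.ext_ring ?_
  simp only [LinearMap.comp_apply, Finsupp.lsingle_apply, LinearMap.sub_apply,
    LinearMap.smul_apply]
  rw [single_eq_koszulVec, relabel_insert_koszulVec hvS _ β.2.1,
    relabel_incl_koszulVec _ _ β.2.1, koszulD_insert_koszulVec hv _ β.2,
    koszulD_koszulVec k S _ _ β.2, map_sum]
  congr 1
  refine Finset.sum_congr rfl fun j _ => ?_
  rw [map_smul, relabel_insert_koszulVec hvS _ ((Finset.erase_subset _ _).trans β.2.1)]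

theorem koszulD_insert_zero {S : Finset (Fin n)} {v : Fin n} (hv : ∀ x ∈ S, v < x) (hvS : v ∉ S)
    (z : KoszulIndex S 0 →₀ MvPolynomial (Fin n) k) :
    koszulD k (insert v S) 0 (relabel k (koszulInsert hvS 0) z) =
      relabel k (koszulIncl (Finset.subset_insert v S) 0)
        ((X v : MvPolynomial (Fin n) k) • z) := by
  suffices koszulD k (insert v S) 0 ∘ₗ relabel k (koszulInsert hvS 0) =
      (X v : MvPolynomial (Fin n) k) •
        relabel k (koszulIncl (Finset.subset_insert v S) 0) by
    simpa using LinearMap.congr_fun this z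
  refine Finsupp.lhom_ext' fun β => LinearMap.ext_ring ?_
  simp only [LinearMap.comp_apply, Finsupp.lsingle_apply, LinearMap.smul_apply]
  rw [single_eq_koszulVec, relabel_insert_koszulVec hvS _ β.2.1,
    relabel_incl_koszulVec _ _ β.2.1, koszulD_insert_koszulVec hv _ β.2,
    Finset.card_eq_zero.1 β.2.2, Finset.sum_empty, sub_zero]

theorem koszulIncl_injective {S S' : Finset (Fin n)} (h : S ⊆ S') (i : ℕ) :
    Function.Injective (koszulIncl h i) := fun α β hαβ =>
  Subtype.ext (show (koszulIncl h i α).1 = (koszulIncl h i β).1 by rw [hαβ])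

theorem koszul_bijective {S : Finset (Fin n)} {v : Fin n} (hvS : v ∉ S) (i : ℕ) :
    Function.Bijective
      (Sum.elim (koszulIncl (Finset.subset_insert v S) (i + 1)) (koszulInsert hvS i)) := by
  constructor
  · rintro (α | α) (β | β) h
    · exact congrArg _ (koszulIncl_injective (Finset.subset_insert v S) _ h)
    · have : α.1 = insert v β.1 := congrArg Subtype.val h
      exact absurd (α.2.1 (this ▸ Finset.mem_insert_self v β.1)) hvS
    · have : insert v α.1 = β.1 := congrArg Subtype.val h
      exact absurd (β.2.1 (this ▸ Finset.mem_insert_self v α.1)) hvS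
    · have : insert v α.1 = insert v β.1 := congrArg Subtype.val h
      have h1 := Finset.erase_insert fun hv => hvS (α.2.1 hv)
      rw [this, Finset.erase_insert fun hv => hvS (β.2.1 hv)] at h1
      exact congrArg _ (Subtype.ext h1.symm)
  · rintro ⟨α, hα, hc⟩
    by_cases hv : v ∈ α
    · refine ⟨.inr ⟨α.erase v, ?_, ?_⟩, Subtype.ext (Finset.insert_erase hv)⟩
      · rw [← Finset.subset_insert_iff]
        exact hα
      · rw [Finset.card_erase_of_mem hv, hc]
        rfl
    · exact ⟨.inl ⟨α, (Finset.subset_insert_iff_of_notMem hv).1 hα, hc⟩, rfl⟩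

instance (S : Finset (Fin n)) : Unique (KoszulIndex S 0) where
  default := ⟨∅, by simp⟩
  uniq α := Subtype.ext (Finset.card_eq_zero.1 α.2.2)

theorem koszulAug_exact (S : Finset (Fin n)) {J : Ideal (MvPolynomial (Fin n) k)}
    (hJ : J = Ideal.span (X '' (S : Set (Fin n)))) :
    Function.Exact (koszulD k S 0) (Finsupp.linearCombination (MvPolynomial (Fin n) k)
      (fun _ : KoszulIndex S 0 => (1 : MvPolynomial (Fin n) k ⧸ J))) := by
  have hsing : ∀ α : KoszulIndex S 1, ∃ v ∈ S, α.1 = {v} := by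
    rintro ⟨α, hα, hc⟩
    obtain ⟨v, rfl⟩ := Finset.card_eq_one.1 hc
    exact ⟨v, hα (Finset.mem_singleton_self v), rfl⟩
  choose f hf hf' using hsing
  refine exact_presentation (fun α => X (f α)) ?_ ?_
  · rw [hJ]
    congr 1
    ext x
    constructor
    · rintro ⟨v, hv, rfl⟩
      refine ⟨⟨{v}, by simpa using hv, by simp⟩, ?_⟩
      have := hf' ⟨{v}, by simpa using hv, by simp⟩
      simp only [Finset.singleton_inj] at this
      simp only [← this]
    · rintro ⟨α, rfl⟩
      exact ⟨f α, hf α, rfl⟩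
  · intro α
    rw [single_eq_koszulVec, koszulD_koszulVec k S 0 _ α.2, hf', Finset.sum_singleton,
      Finset.erase_singleton, koszulVec, dif_pos ⟨Finset.empty_subset _, rfl⟩]
    have : pos {f α} (f α) = 1 := pos_insert_self (α := ∅) (by simp)
    rw [this, Finsupp.smul_single, smul_eq_mul, mul_one]
    congr 1
    ring

/-- Multiplication by x_v changes only the exponent of v, so a variable of S dividing the product
already divides the monomial. -/
theorem X_mul_mem_span_X_image {S : Finset (Fin n)} {v : Fin n} (hv : v ∉ S)
    {f : MvPolynomial (Fin n) k} (h : X v * f ∈ Ideal.span (X '' (S : Set (Fin n)))) :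
    f ∈ Ideal.span (X '' (S : Set (Fin n))) := by
  classical
  rw [mem_ideal_span_X_image] at h ⊢
  intro u hu
  obtain ⟨w, hw, hne⟩ := h (Finsupp.single v 1 + u) (by
    rw [support_X_mul]
    exact Finset.mem_map.2 ⟨u, hu, rfl⟩)
  refine ⟨w, hw, ?_⟩
  have hvw : v ≠ w := by
    rintro rfl
    exact hv hw
  simpa [Finsupp.single_apply, hvw] using hne

/-- Induction on S by adding a new least element v. In the lowest degree the cone argument needs
that x_v is a nonzerodivisor modulo the variables in S. -/
theorem koszul_exact (S : Finset (Fin n)) (i : ℕ) :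
    Function.Exact (koszulD k S (i + 1)) (koszulD k S i) := by
  induction S using Finset.induction_on_min generalizing i with
  | empty =>
    have hemp : ∀ i, IsEmpty (KoszulIndex (∅ : Finset (Fin n)) (i + 1)) := by
      refine fun i => ⟨fun α => ?_⟩
      have := α.2.2
      rw [Finset.subset_empty.1 α.2.1] at this
      simp at this
    intro x
    have := hemp i
    exact ⟨fun _ => ⟨0, Subsingleton.elim _ _⟩, fun _ => by rw [Subsingleton.elim x 0, map_zero]⟩
  | insert v S hv ih =>
    have hvS : v ∉ S := fun h => lt_irrefl v (hv v h)
    have hD : ∀ x, koszulD k (insert v S) i (koszulD k (insert v S) (i + 1) x) = 0 :=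
      LinearMap.congr_fun (koszulD_comp k (insert v S) i)
    have hdec := exists_mapDomain_add (R := MvPolynomial (Fin n) k) (koszul_bijective hvS i).2
    cases i with
    | zero =>
      refine exact_of_cone (ih 0) (koszulAug_exact S rfl) hD hdec (ψ₀ := LinearMap.lsmul _ _ (X v))
        (ψ₁ := LinearMap.lsmul _ _ (X v)) ?_ (koszulD_incl (Finset.subset_insert v S) 1)
        (koszulD_insert_succ hv hvS 0) (fun z => by simp)
      intro y z h
      rw [map_add, koszulD_incl, koszulD_insert_zero hv, ← map_add] at h
      have h := Finsupp.mapDomain_injective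
        (koszulIncl_injective (Finset.subset_insert v S) 0)
        (h.trans Finsupp.mapDomain_zero.symm)
      refine ⟨h, ?_⟩
      -- The augmentation kills the boundary and leaves x_v times the class of z.
      have h2 := congrArg (Finsupp.linearCombination (MvPolynomial (Fin n) k)
        (fun _ : KoszulIndex S 0 => (1 : MvPolynomial (Fin n) k ⧸
          (Ideal.span (X '' (S : Set (Fin n))) : Ideal (MvPolynomial (Fin n) k))))) h
      rw [map_add, map_zero, (koszulAug_exact S rfl _).2 ⟨y, rfl⟩, zero_add, map_smul] at h2
      obtain ⟨f, hf⟩ := Ideal.Quotient.mk_surjective (Finsupp.linearCombination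
        (MvPolynomial (Fin n) k) (fun _ : KoszulIndex S 0 => (1 : MvPolynomial (Fin n) k ⧸
          (Ideal.span (X '' (S : Set (Fin n))) : Ideal (MvPolynomial (Fin n) k)))) z)
      rw [← hf] at h2
      change Ideal.Quotient.mk _ (X v * f) = 0 at h2
      rw [Ideal.Quotient.eq_zero_iff_mem] at h2
      rw [← hf, Ideal.Quotient.eq_zero_iff_mem]
      exact X_mul_mem_span_X_image hvS h2
    | succ i =>
      refine exact_of_cone (ih (i + 1)) (ih i) hD hdec (ψ₀ := LinearMap.lsmul _ _ (X v))
        (ψ₁ := LinearMap.lsmul _ _ (X v)) ?_ (koszulD_incl (Finset.subset_insert v S) (i + 2))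
        (koszulD_insert_succ hv hvS (i + 1)) (fun z => by simp)
      intro y z h
      rw [map_add, koszulD_incl, koszulD_insert_succ hv, add_sub, ← map_add, sub_eq_add_neg,
        ← map_neg] at h
      obtain ⟨h1, h2⟩ := eq_zero_of_mapDomain_add (koszul_bijective hvS i).1 h
      exact ⟨h1, neg_eq_zero.1 h2⟩

theorem koszul_isMinimalGradedFreeResolution (S : Finset (Fin n))
    {J : Ideal (MvPolynomial (Fin n) k)} (hJ : J = Ideal.span (X '' (S : Set (Fin n)))) :
    IsMinimalGradedFreeResolution J (koszul k S) (koszulBasis k S) (fun _ α => expo α.1)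
      (koszulAug k S J) := by
  refine isMinimalGradedFreeResolution_freeComplex (koszulD_comp k S)
    (deg := fun _ α => expo α.1) ?_ ?_ ?_ (koszulAug_exact S hJ) (koszul_exact S)
  · intro α
    rw [Finset.card_eq_zero.1 α.2.2]
    rfl
  · intro i α β u hu
    rw [single_eq_koszulVec, koszulD_koszulVec k S _ _ α.2] at hu
    obtain ⟨j, hj, rfl, h⟩ := exists_of_mem_support_sum (fun j _ => by
      rw [koszulVec_apply]
      split_ifs
      · exact Or.inr rfl
      · exact Or.inl rfl) hu
    rw [koszulVec_apply] at h
    split_ifs at h with he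
    · rw [← he]
      exact Finset.add_sum_erase α.1 (fun i => Finsupp.single i 1) hj
    · exact absurd h zero_ne_one
  · intro i α
    rw [single_eq_koszulVec, koszulD_koszulVec k S _ _ α.2]
    exact sum_mem_varIdeal_smul _ _ _ _

end

end HomCone

namespace HomCone

/-! ### The cellular complex as a cone -/

section

variable {n d : ℕ} {V : Finset (Fin n)} {G H : Finset (Finset (Fin n))} {m : Finset (Fin n)}

theorem IsCell.mono {σ : Fin d → Finset (Fin n)} (h : IsCell d G σ) (hGH : G ⊆ H) :
    IsCell d H σ :=
  ⟨h.1, h.2.1, fun v hv => hGH (h.2.2 v hv)⟩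

/-- The inclusion of the faces of `X_G` into those of `X_H`. -/
def cellIncl (hGH : G ⊆ H) : ∀ i, CellIndex d G i → CellIndex d H i
  | 0, _ => .empty
  | _ + 1, .cell σ h => .cell σ ⟨h.1.mono hGH, h.2⟩

theorem CellIndex.eq_cell {i : ℕ} (σ : CellIndex d H (i + 1)) :
    ∃ h : IsCell d H σ.sets ∧ cellDim σ.sets = i, σ = .cell σ.sets h := by
  cases σ with
  | cell σ h => exact ⟨h, rfl⟩

theorem CellIndex.sets_injective {i : ℕ} :
    Function.Injective (CellIndex.sets : CellIndex d H (i + 1) → _) := by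
  intro σ τ he
  cases σ with
  | cell σ h =>
    cases τ with
    | cell τ h' =>
      obtain rfl : σ = τ := he
      rfl

instance : Unique (CellIndex d H 0) where
  default := .empty
  uniq σ := by cases σ; rfl

instance (i : ℕ) : Finite (CellIndex d H i) := by
  cases i with
  | zero => infer_instance
  | succ i => exact Finite.of_injective _ CellIndex.sets_injective

theorem isEmpty_cellIndex_empty (i : ℕ) :
    IsEmpty (CellIndex d (∅ : Finset (Finset (Fin n))) (i + 1)) := by
  refine ⟨fun σ => ?_⟩
  obtain ⟨h, -⟩ := σ.eq_cell
  exact Finset.notMem_empty _ (h.1.2.2 (fun l => (h.1.1 l).choose) fun l => (h.1.1 l).choose_spec)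

theorem sets_cellIncl (hGH : G ⊆ H) {i : ℕ} (σ : CellIndex d G (i + 1)) :
    (cellIncl hGH (i + 1) σ).sets = σ.sets := by
  cases σ; rfl

theorem cellIncl_injective (hGH : G ⊆ H) (i : ℕ) :
    Function.Injective (cellIncl (d := d) hGH i) := by
  cases i with
  | zero => exact Function.injective_of_subsingleton _
  | succ i =>
    intro σ τ h
    apply CellIndex.sets_injective
    rw [← sets_cellIncl hGH σ, h, sets_cellIncl]

/-- `m` is the lexicographically smallest edge of `H`. -/
structure IsLast (d : ℕ) (V : Finset (Fin n)) (H : Finset (Finset (Fin n))) (m : Finset (Fin n)) :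
    Prop where
  isExchange : IsExchange d V H
  mem : m ∈ H
  lt : ∀ m' ∈ H, m' ≠ m → toLex (expo m) < toLex (expo m')

theorem IsLast.before_eq (h : IsLast d V H m) : before H m = H.erase m := by
  ext m'
  rw [before, Finset.mem_filter, Finset.mem_erase, and_comm]
  refine and_congr_left fun hm' => ⟨?_, h.lt m' hm'⟩
  rintro hlt rfl
  exact lt_irrefl _ hlt

theorem IsLast.isExchange_erase (h : IsLast d V H m) : IsExchange d V (H.erase m) := by
  refine h.isExchange.of_upper (Finset.erase_subset _ _) fun m₁ hm₁ m₂ hm₂ hlt => ?_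
  refine Finset.mem_erase.2 ⟨?_, hm₂⟩
  rintro rfl
  obtain ⟨h1, h2⟩ := Finset.mem_erase.1 hm₁
  exact lt_asymm hlt (h.lt m₁ h2 h1)

/-- An exchange in m' gives an edge lexicographically larger than m', which cannot be the smallest
edge m. -/
theorem IsLast.isLinear_erase (h : IsLast d V H m) {m' α : Finset (Fin n)} (hm' : m' ∈ H)
    (hne : m' ≠ m) (hα : IsLinear H m' α) : IsLinear (H.erase m) m' α := by
  intro a ha
  obtain ⟨p, hp, hpart⟩ := hα a ha
  refine ⟨p, hp, hpart.1, hpart.2.1, Finset.mem_erase.2 ⟨fun he => ?_, hpart.2.2⟩⟩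
  have := lex_lt_exchange hpart.notMem hpart.2.1
  rw [he] at this
  exact lt_asymm this (h.lt m' hm' hne)

variable (k : Type*) [Field k]

theorem IsLast.colon_eq (h : IsLast d V H m) :
    (edgeIdeal k (H.erase m)).colon {mon k m} =
      Ideal.span (X '' (linSet k H m : Set (Fin n))) := by
  rw [← h.before_eq, h.isExchange.colon_eq k h.mem]

theorem IsLast.isLinear (h : IsLast d V H m) {i : ℕ} (α : KoszulIndex (linSet k H m) i) :
    IsLinear H m α.1 :=
  (h.isExchange.isLinear_iff k h.mem).2 α.2.1

/-- The cells with the vertex `m`. -/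
def symbolCell (h : IsLast d V H m) (i : ℕ) (α : KoszulIndex (linSet k H m) i) :
    CellIndex d H (i + 1) :=
  .cell (cellOf d m α.1) ⟨h.isExchange.isCell_cellOf h.mem (h.isLinear k α),
    (h.isExchange.cellDim_cellOf h.mem (h.isLinear k α)).trans α.2.2⟩

/-- A cell with maxima m is some (m;α). Any other cell has a symbol that is also a symbol for H \ m,
by `IsLast.isLinear_erase`. The two kinds are disjoint because (m;α) has the vertex m. -/
theorem IsLast.bijective (h : IsLast d V H m) (i : ℕ) :
    Function.Bijective
      (Sum.elim (cellIncl (d := d) (Finset.erase_subset m H) (i + 1)) (symbolCell k h i)) := by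
  have hc := h.isExchange.card m h.mem
  have hdisj : ∀ (σ : CellIndex d (H.erase m) (i + 1)) (α : KoszulIndex (linSet k H m) i),
      cellIncl (Finset.erase_subset m H) (i + 1) σ ≠ symbolCell k h i α := by
    intro σ α he
    have he' : σ.sets = cellOf d m α.1 := by
      rw [← sets_cellIncl (Finset.erase_subset m H), he]
      rfl
    obtain ⟨hσ, -⟩ := σ.eq_cell
    have := hσ.1.2.2 _ (he'.symm ▸ (isTop_cellOf hc α.1).mem)
    rw [Finset.image_orderEmbOfFin_univ] at this
    exact Finset.notMem_erase _ _ this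
  constructor
  · rintro (σ | α) (τ | β) he
    · exact congrArg _ (cellIncl_injective (Finset.erase_subset m H) _ he)
    · exact absurd he (hdisj σ β)
    · exact absurd he.symm (hdisj τ α)
    · have he' : cellOf d m α.1 = cellOf d m β.1 := congrArg CellIndex.sets he
      exact congrArg _ (Subtype.ext
        (cellOf_injective hc hc (h.isLinear k α) (h.isLinear k β) he').2)
  · intro σ
    obtain ⟨⟨hσ, hdim⟩, he⟩ := σ.eq_cell
    obtain ⟨u, hu⟩ := hσ.exists_isTop
    obtain ⟨m', hm', α, -, -, hα, hα'⟩ := hu.exists_symbol hσ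
    rcases eq_or_ne m' m with rfl | hne
    · have hα₁ : α ⊆ linSet k H m' ∧ α.card = i := ⟨(h.isExchange.isLinear_iff k hm').1 hα, by
        rw [← h.isExchange.cellDim_cellOf hm' hα, hα', hdim]⟩
      refine ⟨.inr ⟨α, hα₁⟩, CellIndex.sets_injective (Eq.trans ?_ hα')⟩
      rfl
    · have hcell := h.isExchange_erase.isCell_cellOf (Finset.mem_erase.2 ⟨hne, hm'⟩)
        (h.isLinear_erase hm' hne hα)
      rw [hα'] at hcell
      exact ⟨.inl (.cell σ.sets ⟨hcell, hdim⟩), CellIndex.sets_injective rfl⟩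

variable {k}

theorem single_eq_cellVec {i : ℕ} (σ : CellIndex d H (i + 1)) :
    (Finsupp.single σ 1 : CellIndex d H (i + 1) →₀ MvPolynomial (Fin n) k) =
      cellVec k d H i σ.sets := by
  obtain ⟨h, he⟩ := σ.eq_cell
  rw [cellVec, dif_pos h, ← he]

theorem cellVec_apply (i : ℕ) (τ : Fin d → Finset (Fin n)) (σ : CellIndex d H (i + 1)) :
    cellVec k d H i τ σ = if τ = σ.sets then 1 else 0 := by
  classical
  obtain ⟨h, he⟩ := σ.eq_cell
  rw [cellVec]
  split_ifs with h1 h2 h2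
  · rw [show CellIndex.cell τ h1 = σ from CellIndex.sets_injective h2, Finsupp.single_eq_same]
  · rw [Finsupp.single_eq_of_ne]
    rintro rfl
    exact h2 rfl
  · subst h2
    exact absurd h h1
  · rfl

theorem relabel_cellVec (hGH : G ⊆ H) (i : ℕ) {σ : Fin d → Finset (Fin n)} (hσ : IsCell d G σ) :
    relabel k (cellIncl hGH (i + 1)) (cellVec k d G i σ) = cellVec k d H i σ := by
  by_cases hd : cellDim σ = i
  · rw [cellVec, cellVec, dif_pos ⟨hσ, hd⟩, dif_pos ⟨hσ.mono hGH, hd⟩]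
    simp [cellIncl]
  · rw [cellVec, cellVec, dif_neg (fun h => hd h.2), dif_neg (fun h => hd h.2), map_zero]

theorem cellD_single_zero (σ : CellIndex d H 1) :
    cellD k d H 0 (Finsupp.single σ 1) = Finsupp.single .empty (monomial (cellLabel σ.sets) 1) := by
  rw [cellD, Finsupp.linearCombination_single, one_smul]

theorem cellD_single_succ {i : ℕ} (σ : CellIndex d H (i + 2)) :
    cellD k d H (i + 1) (Finsupp.single σ 1) = ∑ q ∈ removable σ.sets,
      ((-1) ^ signExp σ.sets q.1 q.2 * X q.2 : MvPolynomial (Fin n) k) •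
        cellVec k d H i (del σ.sets q.1 q.2) := by
  rw [cellD, Finsupp.linearCombination_single, one_smul]

theorem cellD_incl (hGH : G ⊆ H) (i : ℕ)
    (y : CellIndex d G (i + 1) →₀ MvPolynomial (Fin n) k) :
    cellD k d H i (relabel k (cellIncl hGH (i + 1)) y) =
      relabel k (cellIncl hGH i) (cellD k d G i y) := by
  suffices cellD k d H i ∘ₗ relabel k (cellIncl hGH (i + 1)) =
      relabel k (cellIncl hGH i) ∘ₗ cellD k d G i from LinearMap.congr_fun this y
  refine Finsupp.lhom_ext' fun σ => LinearMap.ext_ring ?_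
  simp only [LinearMap.comp_apply, Finsupp.lsingle_apply]
  rw [show relabel k (cellIncl hGH (i + 1)) (Finsupp.single σ 1) =
    (Finsupp.single (cellIncl hGH (i + 1) σ) 1 : _ →₀ MvPolynomial (Fin n) k) by simp]
  cases i with
  | zero =>
    rw [cellD_single_zero, cellD_single_zero, sets_cellIncl]
    simp [cellIncl]
  | succ i =>
    rw [cellD_single_succ, cellD_single_succ, sets_cellIncl, map_sum]
    refine Finset.sum_congr rfl fun q hq => ?_
    obtain ⟨h, -⟩ := σ.eq_cell
    rw [map_smul, relabel_cellVec hGH _ (isCell_del h.1 hq)]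

variable (k)

/-- The comparison map from the Koszul complex to the cellular complex of the remaining edges. -/
noncomputable def comparison (d : ℕ) (H : Finset (Finset (Fin n))) (m : Finset (Fin n)) : ∀ i,
    (KoszulIndex (linSet k H m) i →₀ MvPolynomial (Fin n) k) →ₗ[MvPolynomial (Fin n) k]
      (CellIndex d (H.erase m) i →₀ MvPolynomial (Fin n) k)
  | 0 => Finsupp.linearCombination _ fun _ => Finsupp.single .empty (mon k m)
  | i + 1 => Finsupp.linearCombination _ fun α =>
      ∑ q ∈ (removable (cellOf d m α.1)).filter (fun q => q.2 ∈ m),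
        ((-1) ^ signExp (cellOf d m α.1) q.1 q.2 * X q.2 : MvPolynomial (Fin n) k) •
          cellVec k d (H.erase m) i (del (cellOf d m α.1) q.1 q.2)

/-- If m were still a vertex, the removed element would be a coordinate of it; as the factors are
disjoint, it would lie in the very factor from which it was removed. -/
theorem IsLast.isCell_del_erase (h : IsLast d V H m) {α : Finset (Fin n)} (hα : IsLinear H m α)
    {q : Fin d × Fin n} (hq : q ∈ removable (cellOf d m α)) (hqm : q.2 ∈ m) :
    IsCell d (H.erase m) (del (cellOf d m α) q.1 q.2) := by
  have hcell := isCell_del (h.isExchange.isCell_cellOf h.mem hα) hq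
  refine ⟨hcell.1, hcell.2.1, fun v hv => Finset.mem_erase.2 ⟨fun he => ?_, hcell.2.2 v hv⟩⟩
  rw [← he] at hqm
  obtain ⟨l, -, hl⟩ := Finset.mem_image.1 hqm
  have hmem := hv l
  rw [hl] at hmem
  obtain rfl := (isTop_cellOf (h.isExchange.card m h.mem) α).index_unique
    (mem_removable.1 hq).1 (del_subset _ _ _ _ hmem)
  simp [del] at hmem

theorem IsLast.relabel_symbolCell (h : IsLast d V H m) (i : ℕ)
    (α : KoszulIndex (linSet k H m) i) :
    relabel k (symbolCell k h i) (Finsupp.single α 1) =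
      cellVec k d H i (cellOf d m α.1) := by
  have : relabel k (symbolCell k h i) (Finsupp.single α 1) =
    (Finsupp.single (symbolCell k h i α) 1 : _ →₀ MvPolynomial (Fin n) k) := by simp
  rw [this, single_eq_cellVec]
  rfl

theorem IsLast.relabel_symbolCell_koszulVec (h : IsLast d V H m) {i : ℕ} {α : Finset (Fin n)}
    (hα : α ⊆ linSet k H m ∧ α.card = i) :
    relabel k (symbolCell k h i) (koszulVec k (linSet k H m) i α) =
      cellVec k d H i (cellOf d m α) := by
  rw [koszulVec, dif_pos hα, h.relabel_symbolCell k]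

theorem IsLast.cellD_symbol_zero (h : IsLast d V H m)
    (z : KoszulIndex (linSet k H m) 0 →₀ MvPolynomial (Fin n) k) :
    cellD k d H 0 (relabel k (symbolCell k h 0) z) =
      relabel k (cellIncl (Finset.erase_subset m H) 0) (comparison k d H m 0 z) := by
  suffices cellD k d H 0 ∘ₗ relabel k (symbolCell k h 0) =
      relabel k (cellIncl (Finset.erase_subset m H) 0) ∘ₗ comparison k d H m 0 from
    LinearMap.congr_fun this z
  refine Finsupp.lhom_ext' fun α => LinearMap.ext_ring ?_
  simp only [LinearMap.comp_apply, Finsupp.lsingle_apply]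
  rw [h.relabel_symbolCell k, Finset.card_eq_zero.1 α.2.2, h.isExchange.cellD_zero_cellOf k h.mem,
    comparison, Finsupp.linearCombination_single, one_smul]
  simp [cellIncl]

/-- Facets omitting an element of m give the comparison map. Those omitting an element of α give the
Koszul differential with opposite sign, its exponents being larger by one. -/
theorem IsLast.cellD_symbol_succ (h : IsLast d V H m) (i : ℕ)
    (z : KoszulIndex (linSet k H m) (i + 1) →₀ MvPolynomial (Fin n) k) :
    cellD k d H (i + 1) (relabel k (symbolCell k h (i + 1)) z) =
      relabel k (cellIncl (Finset.erase_subset m H) (i + 1)) (comparison k d H m (i + 1) z) -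
        relabel k (symbolCell k h i) (koszulD k (linSet k H m) i z) := by
  suffices cellD k d H (i + 1) ∘ₗ relabel k (symbolCell k h (i + 1)) =
      relabel k (cellIncl (Finset.erase_subset m H) (i + 1)) ∘ₗ comparison k d H m (i + 1) -
        relabel k (symbolCell k h i) ∘ₗ koszulD k (linSet k H m) i from
    LinearMap.congr_fun this z
  refine Finsupp.lhom_ext' fun α => LinearMap.ext_ring ?_
  simp only [LinearMap.comp_apply, Finsupp.lsingle_apply, LinearMap.sub_apply]
  have hα := h.isLinear k α
  rw [h.relabel_symbolCell k, h.isExchange.cellD_cellOf k h.mem hα α.2.2, single_eq_koszulVec,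
    koszulD_koszulVec k _ _ _ α.2, ← single_eq_koszulVec, comparison,
    Finsupp.linearCombination_single, one_smul, map_sum, map_sum, sub_eq_add_neg,
    ← Finset.sum_neg_distrib]
  refine (add_comm _ _).trans ?_
  congr 1
  · refine Finset.sum_congr rfl fun q hq => ?_
    rw [Finset.mem_filter] at hq
    rw [map_smul, relabel_cellVec _ _ (h.isCell_del_erase hα hq.1 hq.2)]
  · refine Finset.sum_congr rfl fun j hj => ?_
    rw [map_smul, h.relabel_symbolCell_koszulVec k ⟨(Finset.erase_subset _ _).trans α.2.1, by
      rw [Finset.card_erase_of_mem hj, α.2.2, Nat.add_sub_cancel]⟩, ← neg_smul]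
    congr 1
    ring

theorem cellIncl_relabel_injective (hGH : G ⊆ H) (i : ℕ) :
    Function.Injective (relabel k (n := n) (cellIncl (d := d) hGH i)) :=
  Finsupp.mapDomain_injective (cellIncl_injective hGH i)

/-- Applying the square-zero cellular differential to the symbols leaves this identity inside the
complex of H, and the inclusion of the complex of H \ m is injective. -/
theorem IsLast.comparison_comm (h : IsLast d V H m) (i : ℕ)
    (z : KoszulIndex (linSet k H m) (i + 1) →₀ MvPolynomial (Fin n) k) :
    comparison k d H m i (koszulD k (linSet k H m) i z) =
      cellD k d (H.erase m) i (comparison k d H m (i + 1) z) := by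
  apply cellIncl_relabel_injective k (Finset.erase_subset m H)
  have hD := LinearMap.congr_fun (cellD_comp k d H i) (relabel k (symbolCell k h (i + 1)) z)
  rw [LinearMap.comp_apply, LinearMap.zero_apply] at hD
  rw [← cellD_incl, sub_eq_iff_eq_add.1 (h.cellD_symbol_succ k i z).symm, map_add, hD, zero_add]
  cases i with
  | zero => rw [h.cellD_symbol_zero k]
  | succ i =>
    rw [h.cellD_symbol_succ k, ← LinearMap.comp_apply (koszulD k _ i), koszulD_comp,
      LinearMap.zero_apply, map_zero, sub_zero]

/-- The colon ideal is the kernel of multiplication by f into R / I. This starts the cone argument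
in the lowest degree. -/
theorem mulQuot_injective {R : Type*} [CommRing R] (I : Ideal R) (f : R) :
    Function.Injective (mulQuot I f) := by
  rw [injective_iff_map_eq_zero]
  intro x hx
  obtain ⟨r, rfl⟩ := Ideal.Quotient.mk_surjective x
  change Ideal.Quotient.mk I (r * f) = 0 at hx
  rw [Ideal.Quotient.eq_zero_iff_mem] at hx ⊢
  exact Submodule.mem_colon_singleton.2 hx

theorem aug_comparison (d : ℕ) (H : Finset (Finset (Fin n))) (m : Finset (Fin n))
    (z : KoszulIndex (linSet k H m) 0 →₀ MvPolynomial (Fin n) k) :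
    Finsupp.linearCombination (MvPolynomial (Fin n) k)
      (fun _ : CellIndex d (H.erase m) 0 => (1 : MvPolynomial (Fin n) k ⧸ edgeIdeal k (H.erase m)))
        (comparison k d H m 0 z) =
      mulQuot (edgeIdeal k (H.erase m)) (mon k m)
        (Finsupp.linearCombination (MvPolynomial (Fin n) k)
          (fun _ : KoszulIndex (linSet k H m) 0 =>
            (1 : MvPolynomial (Fin n) k ⧸ (edgeIdeal k (H.erase m)).colon {mon k m})) z) := by
  suffices Finsupp.linearCombination (MvPolynomial (Fin n) k)
      (fun _ : CellIndex d (H.erase m) 0 => (1 : MvPolynomial (Fin n) k ⧸ edgeIdeal k (H.erase m)))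
        ∘ₗ comparison k d H m 0 = mulQuot (edgeIdeal k (H.erase m)) (mon k m) ∘ₗ
        Finsupp.linearCombination (MvPolynomial (Fin n) k)
          (fun _ : KoszulIndex (linSet k H m) 0 =>
            (1 : MvPolynomial (Fin n) k ⧸ (edgeIdeal k (H.erase m)).colon {mon k m})) from
    LinearMap.congr_fun this z
  refine Finsupp.lhom_ext' fun α => LinearMap.ext_ring ?_
  simp only [LinearMap.comp_apply, Finsupp.lsingle_apply]
  rw [comparison, Finsupp.linearCombination_single, one_smul, Finsupp.linearCombination_single,
    Finsupp.linearCombination_single, one_smul]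
  change Ideal.Quotient.mk _ (mon k m * 1) = Ideal.Quotient.mk _ (1 * mon k m)
  rw [mul_comm]

/-! ### The cellular complex is a minimal resolution -/

/-- The vertices are the symbols (m;∅), and their labels are the generators of the ideal. -/
theorem IsExchange.cellAug_exact (hH : IsExchange d V H) :
    Function.Exact (cellD k d H 0) (Finsupp.linearCombination (MvPolynomial (Fin n) k)
      (fun _ : CellIndex d H 0 => (1 : MvPolynomial (Fin n) k ⧸ edgeIdeal k H))) := by
  refine exact_presentation (fun σ : CellIndex d H 1 => monomial (cellLabel σ.sets) 1) ?_
    fun σ => by rw [cellD_single_zero]; rfl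
  rw [edgeIdeal]
  congr 1
  ext f
  constructor
  · rintro ⟨m, hm, rfl⟩
    refine ⟨.cell (cellOf d m ∅) ⟨hH.isCell_cellOf hm isLinear_empty,
      hH.cellDim_cellOf hm isLinear_empty⟩, ?_⟩
    change monomial (cellLabel (cellOf d m ∅)) 1 = mon k m
    rw [hH.cellLabel_cellOf hm isLinear_empty, Finset.union_empty, mon]
  · rintro ⟨σ, rfl⟩
    obtain ⟨⟨hσ, hdim⟩, -⟩ := σ.eq_cell
    obtain ⟨u, hu⟩ := hσ.exists_isTop
    obtain ⟨m, hm, α, -, -, hα, hα'⟩ := hu.exists_symbol hσ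
    refine ⟨m, hm, ?_⟩
    rw [← hα', hH.cellDim_cellOf hm hα, Finset.card_eq_zero] at hdim
    change mon k m = monomial (cellLabel σ.sets) 1
    rw [← hα', hH.cellLabel_cellOf hm hα, hdim, Finset.union_empty, mon]

theorem IsLast.cell_exact (h : IsLast d V H m)
    (ih : ∀ i, Function.Exact (cellD k d (H.erase m) (i + 1)) (cellD k d (H.erase m) i)) (i : ℕ) :
    Function.Exact (cellD k d H (i + 1)) (cellD k d H i) := by
  have hD : ∀ x, cellD k d H i (cellD k d H (i + 1) x) = 0 :=
    LinearMap.congr_fun (cellD_comp k d H i)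
  have hdec := exists_mapDomain_add (R := MvPolynomial (Fin n) k) (h.bijective k i).2
  cases i with
  | zero =>
    refine exact_of_cone (ih 0) (koszulAug_exact _ (h.colon_eq k)) hD hdec
      (ψ₀ := comparison k d H m 0) (ψ₁ := comparison k d H m 1) ?_
      (cellD_incl (Finset.erase_subset m H) 1) (h.cellD_symbol_succ k 0) (h.comparison_comm k 0)
    intro y z hyz
    rw [map_add, cellD_incl, h.cellD_symbol_zero k, ← map_add] at hyz
    have hyz := cellIncl_relabel_injective k (Finset.erase_subset m H) 0
      (hyz.trans (map_zero _).symm)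
    -- Modulo the ideal of H \ m the boundary of y vanishes, so m times the augmentation of z is
    -- zero.
    refine ⟨hyz, mulQuot_injective _ _ ?_⟩
    have h2 := congrArg (Finsupp.linearCombination (MvPolynomial (Fin n) k)
      (fun _ : CellIndex d (H.erase m) 0 =>
        (1 : MvPolynomial (Fin n) k ⧸ edgeIdeal k (H.erase m)))) hyz
    rw [map_add, map_zero, (h.isExchange_erase.cellAug_exact k _).2 ⟨y, rfl⟩, zero_add,
      aug_comparison] at h2
    rw [h2, map_zero]
  | succ i =>
    refine exact_of_cone (ih (i + 1)) (koszul_exact _ i) hD hdec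
      (ψ₀ := comparison k d H m (i + 1)) (ψ₁ := comparison k d H m (i + 2)) ?_
      (cellD_incl (Finset.erase_subset m H) (i + 2)) (h.cellD_symbol_succ k (i + 1))
      (h.comparison_comm k (i + 1))
    intro y z hyz
    rw [map_add, cellD_incl, h.cellD_symbol_succ k, add_sub, ← map_add, sub_eq_add_neg,
      ← map_neg] at hyz
    obtain ⟨h1, h2⟩ := eq_zero_of_mapDomain_add (h.bijective k i).1 hyz
    exact ⟨h1, neg_eq_zero.1 h2⟩

/-- Induction on the number of edges: deleting the lexicographically smallest edge preserves the
exchange property. -/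
theorem IsExchange.cell_exact (hH : IsExchange d V H) (i : ℕ) :
    Function.Exact (cellD k d H (i + 1)) (cellD k d H i) := by
  induction hc : H.card generalizing H i with
  | zero =>
    rw [Finset.card_eq_zero] at hc
    subst hc
    intro x
    have := isEmpty_cellIndex_empty (n := n) (d := d) i
    exact ⟨fun _ => ⟨0, Subsingleton.elim _ _⟩, fun _ => by rw [Subsingleton.elim x 0, map_zero]⟩
  | succ c ih =>
    have hne : H.Nonempty := Finset.card_pos.1 (by omega)
    obtain ⟨m, hm, hmin⟩ := Finset.exists_min_image H (fun e => toLex (expo e)) hne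
    have hlast : IsLast d V H m := ⟨hH, hm, fun m' hm' hne' =>
      lt_of_le_of_ne (hmin m' hm') fun he => hne' (expo_injective (toLex.injective he)).symm⟩
    refine hlast.cell_exact k (fun i => ih hlast.isExchange_erase i ?_) i
    rw [Finset.card_erase_of_mem hm, hc, Nat.add_sub_cancel]

theorem IsExchange.isMinimalGradedFreeResolution (hH : IsExchange d V H) :
    IsMinimalGradedFreeResolution (edgeIdeal k H) (homComplex k d H) (cellBasis k d H)
      (cellDeg d H) (cellAug k d H (edgeIdeal k H)) := by
  refine isMinimalGradedFreeResolution_freeComplex (cellD_comp k d H) (deg := cellDeg d H)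
    (fun _ => rfl) ?_ ?_ (hH.cellAug_exact k) (hH.cell_exact k)
  · intro i σ τ u hu
    cases i with
    | zero =>
      classical
      rw [cellD_single_zero, Unique.eq_default τ] at hu
      change u ∈ (Finsupp.single CellIndex.empty (monomial (cellLabel σ.sets) (1 : k))
        CellIndex.empty).support at hu
      rw [Finsupp.single_eq_same, support_monomial, if_neg one_ne_zero,
        Finset.mem_singleton] at hu
      subst hu
      exact add_zero _
    | succ i =>
      rw [cellD_single_succ] at hu
      obtain ⟨q, hq, rfl, h⟩ := exists_of_mem_support_sum (fun j _ => by
        rw [cellVec_apply]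
        split_ifs
        · exact Or.inr rfl
        · exact Or.inl rfl) hu
      rw [cellVec_apply] at h
      split_ifs at h with he
      · change _ + cellLabel τ.sets = cellLabel σ.sets
        rw [← he]
        exact cellLabel_del hq
      · exact absurd h zero_ne_one
  · intro i σ
    cases i with
    | zero =>
      obtain ⟨⟨hσ, -⟩, -⟩ := σ.eq_cell
      -- Since d ≥ 1, the label of a vertex is divisible by a variable; this is minimality at the
      -- empty face.
      have h1 := hH.one_le
      obtain ⟨v, hv⟩ := hσ.1 ⟨0, h1⟩
      have hle : Finsupp.single v 1 ≤ cellLabel σ.sets := by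
        refine le_trans ?_ (Finset.single_le_sum (f := fun l => expo (σ.sets l))
          (fun _ _ => zero_le) (Finset.mem_univ (⟨0, h1⟩ : Fin d)))
        rw [Finsupp.single_le_iff]
        simp [expo_apply, hv]
      have hX : (monomial (cellLabel σ.sets) 1 : MvPolynomial (Fin n) k) =
          monomial (cellLabel σ.sets - Finsupp.single v 1) 1 * X v := by
        rw [X, monomial_mul, tsub_add_cancel_of_le hle, one_mul]
      rw [cellD_single_zero, hX, ← mul_one (_ * X v), ← smul_eq_mul, ← Finsupp.smul_single]
      exact Submodule.smul_mem_smul (Ideal.mul_mem_left _ _ (X_mem_varIdeal v)) trivial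
    | succ i =>
      rw [cellD_single_succ]
      exact sum_mem_varIdeal_smul _ _ _ _

end

end HomCone

namespace HomCone

/-! ### The isomorphism with the mapping cone -/

noncomputable section

open HomologicalComplex homotopyCofiber

variable {n d : ℕ} {V : Finset (Fin n)} {H : Finset (Finset (Fin n))} {m : Finset (Fin n)}
  (k : Type*) [Field k]

theorem down_rel (i : ℕ) : (ComplexShape.down ℕ).Rel (i + 1) i := rfl

theorem not_down_rel_zero (j : ℕ) : ¬ (ComplexShape.down ℕ).Rel 0 j := Nat.succ_ne_zero j

/-- The chain map from the Koszul complex to the cellular complex of the remaining edges. -/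
def comparisonMap (h : IsLast d V H m) :
    koszul k (linSet k H m) ⟶ homComplex k d (H.erase m) :=
  ChainComplex.ofHom (fun i => ModuleCat.ofHom (comparison k d H m i)) fun i => by
    rw [freeComplex_d, freeComplex_d, ← ModuleCat.ofHom_comp, ← ModuleCat.ofHom_comp]
    exact congrArg ModuleCat.ofHom (LinearMap.ext fun z => (h.comparison_comm k i z).symm)

/-- The inclusion of the cellular complex of the remaining edges, in degree `i`. -/
def inclX (H : Finset (Finset (Fin n))) (m : Finset (Fin n)) (i : ℕ) :
    (homComplex k d (H.erase m)).X i ⟶ (homComplex k d H).X i :=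
  ModuleCat.ofHom (relabel k (cellIncl (Finset.erase_subset m H) i))

/-- The map that sends the basis element `e_α` of the Koszul complex to the symbol `(m; α)`. -/
def symbX (h : IsLast d V H m) (i : ℕ) :
    (koszul k (linSet k H m)).X i ⟶ (homComplex k d H).X (i + 1) :=
  ModuleCat.ofHom (relabel k (symbolCell k h i))

theorem inclX_d (i : ℕ) : inclX (d := d) k H m (i + 1) ≫ (homComplex k d H).d (i + 1) i =
    (homComplex k d (H.erase m)).d (i + 1) i ≫ inclX k H m i := by
  rw [freeComplex_d, freeComplex_d, inclX, inclX, ← ModuleCat.ofHom_comp, ← ModuleCat.ofHom_comp]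
  exact congrArg ModuleCat.ofHom (LinearMap.ext (cellD_incl (Finset.erase_subset m H) i))

theorem symbX_d_zero (h : IsLast d V H m) : symbX k h 0 ≫ (homComplex k d H).d 1 0 =
    (comparisonMap k h).f 0 ≫ inclX k H m 0 := by
  rw [freeComplex_d, inclX, symbX]
  exact congrArg ModuleCat.ofHom (LinearMap.ext (h.cellD_symbol_zero k))

theorem symbX_d_succ (h : IsLast d V H m) (i : ℕ) :
    symbX k h (i + 1) ≫ (homComplex k d H).d (i + 2) (i + 1) =
      (comparisonMap k h).f (i + 1) ≫ inclX k H m (i + 1) -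
        (koszul k (linSet k H m)).d (i + 1) i ≫ symbX k h i := by
  rw [freeComplex_d, freeComplex_d, inclX, symbX]
  exact congrArg ModuleCat.ofHom (LinearMap.ext (h.cellD_symbol_succ k i))

/-- The components of the isomorphism from the mapping cone. -/
def coneX (h : IsLast d V H m) : ∀ i : ℕ,
    (homotopyCofiber (comparisonMap k h)).X i ⟶ (homComplex k d H).X i
  | 0 => sndX (comparisonMap k h) 0 ≫ inclX k H m 0
  | i + 1 => fstX (comparisonMap k h) (i + 1) i (down_rel i) ≫ symbX k h i +
      sndX (comparisonMap k h) (i + 1) ≫ inclX k H m (i + 1)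

theorem inlX_coneX (h : IsLast d V H m) (i : ℕ) :
    inlX (comparisonMap k h) i (i + 1) (down_rel i) ≫ coneX k h (i + 1) = symbX k h i := by
  rw [coneX, Preadditive.comp_add, inlX_fstX_assoc, inlX_sndX_assoc, Limits.zero_comp, add_zero]

theorem inrX_coneX (h : IsLast d V H m) (i : ℕ) :
    inrX (comparisonMap k h) i ≫ coneX k h i = inclX k H m i := by
  cases i with
  | zero => rw [coneX, inrX_sndX_assoc]
  | succ i =>
    rw [coneX, Preadditive.comp_add, inrX_fstX_assoc, inrX_sndX_assoc, Limits.zero_comp, zero_add]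

/-- The mapping cone negates the differential of its source, exactly as the cellular differential
does on symbols. -/
theorem coneX_d (h : IsLast d V H m) (i : ℕ) :
    coneX k h (i + 1) ≫ (homComplex k d H).d (i + 1) i =
      (homotopyCofiber (comparisonMap k h)).d (i + 1) i ≫ coneX k h i := by
  refine ext_from_X (comparisonMap k h) i (i + 1) (down_rel i) ?_ ?_
  · rw [← Category.assoc, inlX_coneX, ← Category.assoc]
    cases i with
    | zero =>
      rw [homotopyCofiber_d, inlX_d' _ _ _ _ (not_down_rel_zero _), Category.assoc, inrX_coneX, symbX_d_zero]
    | succ i =>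
      rw [homotopyCofiber_d, inlX_d _ _ _ i (down_rel _) (down_rel i), Preadditive.add_comp, Category.assoc,
        inrX_coneX, Preadditive.neg_comp, Category.assoc, inlX_coneX, symbX_d_succ]
      abel
  · rw [← Category.assoc, inrX_coneX, ← Category.assoc, homotopyCofiber_d, inrX_d, Category.assoc,
      inrX_coneX, inclX_d]

/-- In positive degrees this is the partition of the cells in `IsLast.bijective`; in degree 0 the
cone has only its second summand. -/
theorem coneX_bijective (h : IsLast d V H m) (i : ℕ) :
    Function.Bijective (coneX k h i).hom := by
  set ψ := comparisonMap k h
  cases i with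
  | zero =>
    have hbij : Function.Bijective (inclX (d := d) k H m 0).hom := by
      refine ⟨cellIncl_relabel_injective k _ 0, Finsupp.mapDomain_surjective ?_⟩
      exact fun σ => ⟨default, Subsingleton.elim _ _⟩
    have hsnd : IsIso (sndX ψ 0) := ⟨inrX ψ 0, sndX_inrX ψ 0 (not_down_rel_zero _), inrX_sndX ψ 0⟩
    have := (ConcreteCategory.isIso_iff_bijective (sndX ψ 0)).1 hsnd
    exact hbij.comp this
  | succ i =>
    have hid : fstX ψ (i + 1) i (down_rel i) ≫ inlX ψ i (i + 1) (down_rel i) + sndX ψ (i + 1) ≫ inrX ψ (i + 1) =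
        𝟙 _ := by
      refine ext_to_X ψ (i + 1) i (down_rel i) ?_ ?_ <;> simp
    constructor
    · rw [injective_iff_map_eq_zero]
      intro x hx
      obtain ⟨h1, h2⟩ := eq_zero_of_mapDomain_add (h.bijective k i).1
        ((add_comm _ _).trans hx)
      have := congrArg (fun f => f.hom x) hid
      refine this.symm.trans ?_
      change (inlX ψ i (i + 1) (down_rel i)).hom ((fstX ψ (i + 1) i (down_rel i)).hom x) +
        (inrX ψ (i + 1)).hom ((sndX ψ (i + 1)).hom x) = 0
      erw [h1, h2]
      rw [map_zero, map_zero, add_zero]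
    · intro x
      obtain ⟨y, z, rfl⟩ := exists_mapDomain_add (h.bijective k i).2 x
      refine ⟨(inrX ψ (i + 1)).hom y + (inlX ψ i (i + 1) (down_rel i)).hom z, ?_⟩
      rw [map_add]
      exact congrArg₂ (· + ·) (congrArg (fun f => f.hom y) (inrX_coneX k h (i + 1)))
        (congrArg (fun f => f.hom z) (inlX_coneX k h i))

/-- The mapping cone of the comparison map is the cellular complex. -/
def coneIso (h : IsLast d V H m) :
    homotopyCofiber (comparisonMap k h) ≅ homComplex k d H :=
  have : ∀ i, IsIso (coneX k h i) := fun i =>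
    (ConcreteCategory.isIso_iff_bijective (coneX k h i)).2 (coneX_bijective k h i)
  Hom.isoOfComponents (fun i => asIso (coneX k h i)) (by
    rintro _ i rfl
    exact coneX_d k h i)

theorem IsLast.isConeStep (h : IsLast d V H m) :
    IsConeStep k d (H.erase m) (linSet k H m) m H := by
  refine ⟨h.isExchange_erase.isMinimalGradedFreeResolution k,
    koszul_isMinimalGradedFreeResolution _ (h.colon_eq k), comparisonMap k h,
    aug_comparison k d H m, coneIso k h, fun i α => ?_, ?_, fun i σ => ?_⟩
  · change (inlX (comparisonMap k h) i (i + 1) (down_rel i) ≫ coneX k h (i + 1)).hom _ = _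
    rw [inlX_coneX]
    exact (congrArg (symbX k h i).hom (congrFun Finsupp.coe_basisSingleOne α)).trans
      (h.relabel_symbolCell k i α)
  · change (inrX (comparisonMap k h) 0 ≫ coneX k h 0).hom _ = _
    rw [inrX_coneX]
    refine (congrArg (inclX k H m 0).hom (congrFun Finsupp.coe_basisSingleOne _)).trans
      (Eq.trans ?_ (congrFun Finsupp.coe_basisSingleOne _).symm)
    exact Finsupp.mapDomain_single
  · change (inrX (comparisonMap k h) (i + 1) ≫ coneX k h (i + 1)).hom _ = _
    rw [inrX_coneX]
    obtain ⟨hσ, -⟩ := σ.eq_cell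
    refine (congrArg (inclX k H m (i + 1)).hom
      ((congrFun Finsupp.coe_basisSingleOne σ).trans (single_eq_cellVec σ))).trans ?_
    exact relabel_cellVec (Finset.erase_subset m H) i hσ.1

end

/-! ### Initial segments of the lexicographic list -/

theorem linSet_congr (k : Type*) [Field k] {n : ℕ} {H H' : Finset (Finset (Fin n))}
    {m : Finset (Fin n)} (h : before H m = before H' m) : linSet k H m = linSet k H' m := by
  rw [linSet, linSet, h]

/-- The initial segments of a decreasing list of the edges. -/
theorem IsExchange.isLast_image {n d r : ℕ} {V : Finset (Fin n)}
    {g : Fin r → Finset (Fin n)} (hH : IsExchange d V (Finset.univ.image g))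
    (hg : StrictAnti fun j => toLex (expo (g j))) (j : Fin r) :
    IsLast d V ((Finset.Iic j).image g) (g j) := by
  refine ⟨hH.of_upper (Finset.image_subset_image (Finset.subset_univ _)) ?_,
    Finset.mem_image_of_mem _ (Finset.mem_Iic.2 le_rfl), ?_⟩
  · intro m hm m' hm' hlt
    obtain ⟨i, hi, rfl⟩ := Finset.mem_image.1 hm
    obtain ⟨i', -, rfl⟩ := Finset.mem_image.1 hm'
    exact Finset.mem_image_of_mem _ (Finset.mem_Iic.2
      ((hg.lt_iff_gt.1 hlt).le.trans (Finset.mem_Iic.1 hi)))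
  · intro m' hm' hne
    obtain ⟨i, hi, rfl⟩ := Finset.mem_image.1 hm'
    exact hg (lt_of_le_of_ne (Finset.mem_Iic.1 hi) fun e => hne (e ▸ rfl))

theorem image_Iic_erase {n r : ℕ} {g : Fin r → Finset (Fin n)} (hg : Function.Injective g)
    (j : Fin r) : ((Finset.Iic j).image g).erase (g j) = (Finset.Iio j).image g := by
  rw [← Finset.image_erase hg, Finset.Iic_erase]

theorem before_image {n r : ℕ} {g : Fin r → Finset (Fin n)}
    (hg : StrictAnti fun j => toLex (expo (g j))) (j : Fin r) :
    before (Finset.univ.image g) (g j) = (Finset.Iio j).image g := by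
  ext m
  simp only [before, Finset.mem_filter, Finset.mem_image, Finset.mem_univ, true_and,
    Finset.mem_Iio]
  constructor
  · rintro ⟨⟨i, rfl⟩, hlt⟩
    exact ⟨i, hg.lt_iff_gt.1 hlt, rfl⟩
  · rintro ⟨i, hi, rfl⟩
    exact ⟨⟨i, rfl⟩, hg hi⟩

/-- Only the edges before m_j enter set(m_j), so it is the same for H_j and for H, and the cone step
for the last edge of H_j applies. -/
theorem IsExchange.isConeStep_image (k : Type*) [Field k] {n d r : ℕ} {V : Finset (Fin n)}
    {g : Fin r → Finset (Fin n)} (hH : IsExchange d V (Finset.univ.image g))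
    (hg : StrictAnti fun j => toLex (expo (g j))) (j : Fin r) :
    IsConeStep k d ((Finset.Iio j).image g) (linSet k (Finset.univ.image g) (g j)) (g j)
      ((Finset.Iic j).image g) := by
  have hinj : Function.Injective g := fun i i' h => hg.injective (by simp only [h])
  have hlast := hH.isLast_image hg j
  have hstep := hlast.isConeStep k
  have hlin : linSet k ((Finset.Iic j).image g) (g j) = linSet k (Finset.univ.image g) (g j) :=
    linSet_congr k (by rw [hlast.before_eq, image_Iic_erase hinj, before_image hg])
  rwa [hlin, image_Iic_erase hinj] at hstep

end HomCone

theorem theorem4 {k : Type*} [Field k] {n d r : ℕ} (V : Finset (Fin n))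
    (H : Finset (Finset (Fin n))) (hH : IsCointerval d V H)
    -- the lexicographic list of the generators
    (g : Fin r → Finset (Fin n)) (hg : StrictAnti fun j => toLex (expo (g j)))
    (hgH : Finset.univ.image g = H) :
    -- the cellular complex of `X_H` is a minimal graded free resolution of `R / I_H`
    IsMinimalGradedFreeResolution (edgeIdeal k H) (homComplex k d H) (cellBasis k d H)
      (cellDeg d H) (cellAug k d H (edgeIdeal k H)) ∧
    -- it is an iterated mapping cone, starting from `R` in degree zero
    (∀ i, IsEmpty (CellIndex d (∅ : Finset (Finset (Fin n))) (i + 1))) ∧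
    (∀ j : Fin r, IsConeStep k d ((Finset.Iio j).image g) (linSet k H (g j)) (g j)
      ((Finset.Iic j).image g)) ∧
    -- the basis in degree `i + 1` consists of the symbols `(m; α)` with `|α| = i`
    (∀ i, Set.BijOn (fun s : Finset (Fin n) × Finset (Fin n) => cellOf d s.1 s.2)
      {s | s.1 ∈ H ∧ s.2 ⊆ linSet k H s.1 ∧ s.2.card = i}
      {σ | IsCell d H σ ∧ cellDim σ = i}) ∧
    -- the differential on the symbols `(m; α)` with nonempty `α`
    (∀ (i : ℕ) (m α : Finset (Fin n)), m ∈ H → α ⊆ linSet k H m → α.card = i + 1 →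
      (∀ j ∈ topSet k H m α, decomp j m ∈ H ∧ α.erase j ⊆ linSet k H (decomp j m)) ∧
      ((homComplex k d H).d (i + 2) (i + 1)).hom (symb k d H (i + 1) m α) =
        ∑ j ∈ α, ((-1) ^ pos α j * MvPolynomial.X j : MvPolynomial (Fin n) k) •
            symb k d H i m (α.erase j) +
        ∑ j ∈ topSet k H m α, ((-1) ^ (pos α j - 1) *
            MvPolynomial.monomial (Finsupp.single j 1 + expo m - expo (decomp j m)) 1 :
              MvPolynomial (Fin n) k) •
            symb k d H i (decomp j m) (α.erase j)) ∧
    -- the differential on the symbols `(m; ∅)`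
    (∀ m ∈ H, ((homComplex k d H).d 1 0).hom (symb k d H 0 m ∅) =
      mon k m • cellBasis k d H 0 .empty) := by
  have hE := hH.isExchange
  refine ⟨hE.isMinimalGradedFreeResolution k, isEmpty_cellIndex_empty, fun j => ?_,
    hE.bijOn_cellOf k, fun i m α hm hα hi => hE.differential k i hm hα hi,
    fun m hm => hE.differential_empty k hm⟩
  subst hgH
  exact hE.isConeStep_image k hg j
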